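/- Let $m=GM/c^2>0$, $c>0$, and let $\beta,\gamma,\epsilon,\beta_n,\gamma_n$ ($n\ge 3$) be real parameters. Consider the static, spherically symmetric metric in isotropic coordinates $$ds^2=\mathcal A(r)(dx^0)^2-\mathcal B^{-1}(r)\,\delta_{ij}dx^idx^j,\qquad r=|\mathbf x|,\quad \mathbf x\in\mathbb R^3,\quad x^0=ct,$$ $$\mathcal A(r)=1-\frac{2m}{r}+2\beta\frac{m^2}{r^2}-\frac32\beta_3\frac{m^3}{r^3}+\beta_4\frac{m^4}{r^4}+\sum_{n\ge5}\frac{(-1)^n n}{2^{n-2}}\beta_n\frac{m^n}{r^n},$$ $$\mathcal B^{-1}(r)=1+2\gamma\frac{m}{r}+\frac32\epsilon\frac{m^2}{r^2}+\frac12\gamma_3\frac{m^3}{r^3}+\frac1{16}\gamma_4\frac{m^4}{r^4}+\sum_{n\ge5}(\gamma_n-1)\frac{m^n}{r^n},$$ where both series converge and both functions are positive for $r>r_h$, with $r_h>0$. Let $\mathcal D_h$ be the region $r>r_h$ and put $$\kappa=2(1+\gamma)-\beta+\tfrac34\epsilon,\qquad \kappa_3=2\kappa-2\beta(1+\gamma)+\tfrac34\beta_3+\tfrac14\gamma_3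 .$$ Let $\mathbf x_A,\mathbf x_B\in\mathcal D_h$, $r_A=|\mathbf x_A|$, $r_B=|\mathbf x_B|$, $\mathbf n_A=\mathbf x_A/r_A$, $\mathbf n_B=\mathbf x_B/r_B$, and suppose that $\mathbf n_A\ne\mathbf n_B$ and that $|\mathbf z(\xi)|>r_h$ for $0\le\xi\le1$, where $\mathbf z(\xi)=\mathbf x_A+\xi(\mathbf x_B-\mathbf x_A)$. Let a quasi-Minkowskian light ray joining $\mathbf x_A$ (at time $t_A$) to $\mathbf x_B$ be given, that is, a null geodesic path lying in the domain of regularity, with affine parameter $\xi\in[0,1]$, represented by an expansion in powers of the gravitational constant, $$x^0=ct_A+\xi|\mathbf x_B-\mathbf x_A|+\sum_{n\ge1}X^0_{(n)}(\xi),\qquad \mathbf x=\mathbf z(\xi)+\sum_{n\ge1}\mathbf X_{(n)}(\xi),$$ with $X^0_{(n)}(0)=0$, $\mathbf X_{(n)}(0)=\mathbf X_{(n)}(1)=0$, the terms of index $n$ being of order $G^n$. Precisely: the functions $X^0_{(n)},\mathbf X_{(n)}$ are $C^1$ on $[0,1]$, and for all sufficiently small $\lambda>0$, when $G$ (hence $m$)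 is replaced by $\lambda G$ (hence $\lambda m$) and $X^0_{(n)},\mathbf X_{(n)}$ by $\lambda^nX^0_{(n)},\lambda^n\mathbf X_{(n)}$, the series and the series of the first $\xi$-derivatives converge geometrically, uniformly on $[0,1]$, and their sums define a null geodesic, with affine parameter $\xi$, of the metric with mass parameter $\lambda m$, lying in $r>\lambda r_h$. Let $$\mathcal T=t_B-t_A=\frac{|\mathbf x_B-\mathbf x_A|}{c}+\sum_{n\ge1}\mathcal T^{(n)},\qquad \mathcal T^{(n)}=\frac1c X^0_{(n)}(1),$$ be the resulting expansion of the light travel time in powers of $G$. Then $$\mathcal T^{(2)}=\frac{m^2}{r_Ar_B}\frac{|\mathbf x_B-\mathbf x_A|}{c}\left[\kappa\frac{\arccos \mathbf n_A\cdot\mathbf n_B}{|\mathbf n_A\times\mathbf n_B|}-\frac{(1+\gamma)^2}{1+\mathbf n_A\cdot\mathbf n_B}\right],$$ $$\mathcal T^{(3)}=\frac{m^3}{r_Ar_B}\left(\frac1{r_A}+\frac1{r_B}\right)\frac{|\mathbf x_B-\mathbf x_A|}{c(1+\mathbf n_A\cdot\mathbf n_B)}\left[\kappa_3-(1+\gamma)\kappa\frac{\arccos\mathbf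 n_A\cdot\mathbf n_B}{|\mathbf n_A\times\mathbf n_B|}+\frac{(1+\gamma)^3}{1+\mathbf n_A\cdot\mathbf n_B}\right].$$ -/

import Mathlib

open Set Filter Topology

noncomputable section

/-- The Euclidean space of triples. -/
abbrev E3 := EuclideanSpace ℝ (Fin 3)

/-- The Euclidean vector product of two triples. -/
def vecCross (a b : E3) : E3 :=
  WithLp.toLp 2 (crossProduct (WithLp.ofLp a) (WithLp.ofLp b))

/-- Generalized post-Newtonian parameters. Only the values `betaN n` and `gammaN n` with `3 ≤ n`
are used. -/
structure PPNParameters where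
  beta : ℝ
  gamma : ℝ
  epsilon : ℝ
  betaN : ℕ → ℝ
  gammaN : ℕ → ℝ

namespace PPNParameters

/-- Coefficient of `(m / r) ^ n` in the metric potential `𝒜`. -/
def coeffA (P : PPNParameters) : ℕ → ℝ
  | 0 => 1
  | 1 => -2
  | 2 => 2 * P.beta
  | 3 => -(3 / 2) * P.betaN 3
  | 4 => P.betaN 4
  | k + 5 => (-1) ^ (k + 5) * ((k : ℝ) + 5) / 2 ^ (k + 3) * P.betaN (k + 5)

/-- Coefficient of `(m / r) ^ n` in the metric potential `ℬ⁻¹`. -/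
def coeffBinv (P : PPNParameters) : ℕ → ℝ
  | 0 => 1
  | 1 => 2 * P.gamma
  | 2 => 3 / 2 * P.epsilon
  | 3 => 1 / 2 * P.gammaN 3
  | 4 => 1 / 16 * P.gammaN 4
  | k + 5 => P.gammaN (k + 5) - 1

/-- The potential `𝒜(r)` for the mass parameter `m = G M / c ^ 2`. -/
def potA (P : PPNParameters) (m r : ℝ) : ℝ := ∑' n : ℕ, P.coeffA n * (m ^ n / r ^ n)

/-- The potential `ℬ⁻¹(r)` for the mass parameter `m = G M / c ^ 2`. -/
def potBinv (P : PPNParameters) (m r : ℝ) : ℝ := ∑' n : ℕ, P.coeffBinv n * (m ^ n / r ^ n)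

/-- `κ = κ₂`. -/
def kappa (P : PPNParameters) : ℝ := 2 * (1 + P.gamma) - P.beta + 3 / 4 * P.epsilon

/-- `κ₃`. -/
def kappa3 (P : PPNParameters) : ℝ :=
  2 * P.kappa - 2 * P.beta * (1 + P.gamma) + 3 / 4 * P.betaN 3 + 1 / 4 * P.gammaN 3

/-- The region `r > rh` is a domain of regularity of the metric with mass parameter `m`: there `𝒜`
and `ℬ⁻¹` are positive and are represented by their (convergent) expansions. -/
structure IsRegularOutside (P : PPNParameters) (m rh : ℝ) : Prop where
  summable_A : ∀ r, rh < r → Summable fun n : ℕ => P.coeffA n * (m ^ n / r ^ n)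
  summable_Binv : ∀ r, rh < r → Summable fun n : ℕ => P.coeffBinv n * (m ^ n / r ^ n)
  pos_A : ∀ r, rh < r → 0 < P.potA m r
  pos_Binv : ∀ r, rh < r → 0 < P.potBinv m r

/-- The metric `ds² = 𝒜(r) (dx⁰)² - ℬ⁻¹(r) δᵢⱼ dxⁱ dxʲ` at a point with spatial position `y`, as a
quadratic form evaluated on the tangent vector `(v0, v)`. -/
def metricForm (P : PPNParameters) (m : ℝ) (y : E3) (v0 : ℝ) (v : E3) : ℝ :=
  P.potA m ‖y‖ * v0 ^ 2 - P.potBinv m ‖y‖ * ‖v‖ ^ 2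

/-- The curve `ξ ↦ (x0 ξ, x ξ)`, `0 ≤ ξ ≤ 1`, is an affinely parametrized null geodesic of the
metric. The geodesic equations are written as the Euler-Lagrange equations of the Lagrangian
`metricForm`: `d/dξ (∂L/∂v⁰) = 0` and `d/dξ (∂L/∂v) = ∂L/∂x`. -/
structure IsNullGeodesic (P : PPNParameters) (m : ℝ) (x0 : ℝ → ℝ) (x : ℝ → E3) : Prop where
  contDiffOn_time : ContDiffOn ℝ 2 x0 (Icc 0 1)
  contDiffOn_space : ContDiffOn ℝ 2 x (Icc 0 1)
  time_eq : ∀ ξ ∈ Icc (0 : ℝ) 1,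
    HasDerivWithinAt (fun s => 2 * P.potA m ‖x s‖ * derivWithin x0 (Icc 0 1) s) 0 (Icc 0 1) ξ
  space_eq : ∀ ξ ∈ Icc (0 : ℝ) 1,
    HasDerivWithinAt (fun s => (-2 * P.potBinv m ‖x s‖) • derivWithin x (Icc 0 1) s)
      (gradient (fun y : E3 => P.metricForm m y
        (derivWithin x0 (Icc 0 1) ξ) (derivWithin x (Icc 0 1) ξ)) (x ξ))
      (Icc 0 1) ξ
  null : ∀ ξ ∈ Icc (0 : ℝ) 1,
    P.metricForm m (x ξ) (derivWithin x0 (Icc 0 1) ξ) (derivWithin x (Icc 0 1) ξ) = 0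

end PPNParameters

/-- The straight segment `z(ξ) = xA + ξ (xB - xA)`. -/
def segPoint (xA xB : E3) (ξ : ℝ) : E3 := xA + ξ • (xB - xA)

/-- The coordinate `x⁰` along the ray when the gravitational constant is `lam * G`. The terms `X0 n`
with `1 ≤ n` are of order `n` in the gravitational constant: they refer to the value `G`, and are
multiplied by `lam ^ n` when `G` is replaced by `lam * G`. -/
def rayTime (c tA : ℝ) (xA xB : E3) (X0 : ℕ → ℝ → ℝ) (lam ξ : ℝ) : ℝ :=
  c * tA + ξ * ‖xB - xA‖ + ∑' n : ℕ, lam ^ (n + 1) * X0 (n + 1) ξ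

/-- The spatial position along the ray when the gravitational constant is `lam * G`. -/
def rayPos (xA xB : E3) (X : ℕ → ℝ → E3) (lam ξ : ℝ) : E3 :=
  segPoint xA xB ξ + ∑' n : ℕ, lam ^ (n + 1) • X (n + 1) ξ

/-- The functions `X0 n`, `X n`, `1 ≤ n`, are the perturbation terms of a quasi-Minkowskian light
ray from `xA` (at time `tA`) to `xB`: the curve defined by the expansion of `x⁰` and of `x` in powers
of the gravitational constant is a null geodesic path confined in the domain of regularity.

The gravitational constant `lam * G` corresponds to the mass parameter `lam * m`, and since the
potentials depend on `m` and `r` through `m / r` only, to the domain of regularity `r > lam * rh`.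
The expansions are in powers of `lam`; convergence (together with the first `ξ`-derivatives) and the
geodesic property are required for small `lam > 0`. -/
structure IsQuasiMinkowskianRay (P : PPNParameters) (m rh c tA : ℝ) (xA xB : E3)
    (X0 : ℕ → ℝ → ℝ) (X : ℕ → ℝ → E3) : Prop where
  time_zero : ∀ n, 1 ≤ n → X0 n 0 = 0
  space_zero : ∀ n, 1 ≤ n → X n 0 = 0
  space_one : ∀ n, 1 ≤ n → X n 1 = 0
  contDiffOn_time : ∀ n, 1 ≤ n → ContDiffOn ℝ 1 (X0 n) (Icc 0 1)
  contDiffOn_space : ∀ n, 1 ≤ n → ContDiffOn ℝ 1 (X n) (Icc 0 1)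
  expansion : ∃ lam0 : ℝ, 0 < lam0 ∧
    (∃ C : ℝ, ∀ n, 1 ≤ n → ∀ ξ ∈ Icc (0 : ℝ) 1,
      lam0 ^ n * |X0 n ξ| ≤ C ∧ lam0 ^ n * |derivWithin (X0 n) (Icc 0 1) ξ| ≤ C ∧
      lam0 ^ n * ‖X n ξ‖ ≤ C ∧ lam0 ^ n * ‖derivWithin (X n) (Icc 0 1) ξ‖ ≤ C) ∧
    ∀ lam : ℝ, 0 < lam → lam < lam0 →
      (∀ ξ ∈ Icc (0 : ℝ) 1, lam * rh < ‖rayPos xA xB X lam ξ‖) ∧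
      P.IsNullGeodesic (lam * m) (rayTime c tA xA xB X0 lam) (rayPos xA xB X lam)

/-- The light travel time `tB - tA` when the gravitational constant is `lam * G`. -/
def travelTime (c tA : ℝ) (xA xB : E3) (X0 : ℕ → ℝ → ℝ) (lam : ℝ) : ℝ :=
  (rayTime c tA xA xB X0 lam 1 - rayTime c tA xA xB X0 lam 0) / c

/-- The term `𝒯⁽ⁿ⁾` of order `n` in the expansion of the time transfer function in powers of the
gravitational constant. -/
def timeTransferTerm (c : ℝ) (X0 : ℕ → ℝ → ℝ) (n : ℕ) : ℝ := X0 n 1 / c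

/-- The travel time is `‖xB - xA‖ / c` plus the sum of the terms `timeTransferTerm`. -/
theorem hasSum_travelTime {P : PPNParameters} {m rh c tA : ℝ} {xA xB : E3}
    {X0 : ℕ → ℝ → ℝ} {X : ℕ → ℝ → E3} (h : IsQuasiMinkowskianRay P m rh c tA xA xB X0 X) :
    ∀ᶠ lam in 𝓝[>] (0 : ℝ), HasSum (fun n : ℕ => lam ^ (n + 1) * timeTransferTerm c X0 (n + 1))
      (travelTime c tA xA xB X0 lam - ‖xB - xA‖ / c) := by
  obtain ⟨lam0, h0, ⟨C, hC⟩, -⟩ := h.expansion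
  filter_upwards [Ioo_mem_nhdsGT h0] with lam hlam
  have hs : Summable fun n : ℕ => lam ^ (n + 1) * X0 (n + 1) 1 := by
    have hq : Summable fun n : ℕ => C * (lam / lam0) ^ (n + 1) := by
      have hg := summable_geometric_of_lt_one (div_nonneg hlam.1.le h0.le)
        ((div_lt_one h0).2 hlam.2)
      exact ((summable_nat_add_iff 1).2 hg).mul_left C
    refine Summable.of_norm_bounded hq fun n => ?_
    have hb := (hC (n + 1) (by omega) 1 (by simp)).1
    rw [norm_mul, Real.norm_eq_abs, Real.norm_eq_abs, abs_of_pos (pow_pos hlam.1 _), div_pow]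
    have hp : 0 < lam0 ^ (n + 1) := pow_pos h0 _
    have : |X0 (n + 1) 1| ≤ C / lam0 ^ (n + 1) := by
      rw [le_div_iff₀ hp]; linarith
    calc lam ^ (n + 1) * |X0 (n + 1) 1| ≤ lam ^ (n + 1) * (C / lam0 ^ (n + 1)) :=
          mul_le_mul_of_nonneg_left this (pow_pos hlam.1 _).le
      _ = C * (lam ^ (n + 1) / lam0 ^ (n + 1)) := by ring
  have hz : ∑' n : ℕ, lam ^ (n + 1) * X0 (n + 1) 0 = 0 := by
    simp [h.time_zero]
  have e1 : (fun n : ℕ => lam ^ (n + 1) * timeTransferTerm c X0 (n + 1)) =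
      fun n : ℕ => lam ^ (n + 1) * X0 (n + 1) 1 / c := by
    funext n
    simp only [timeTransferTerm]
    ring
  have e2 : travelTime c tA xA xB X0 lam - ‖xB - xA‖ / c =
      (∑' n : ℕ, lam ^ (n + 1) * X0 (n + 1) 1) / c := by
    simp only [travelTime, rayTime, hz]
    ring
  rw [e1, e2]
  exact hs.hasSum.div_const c

end

/-!
The light ray is a geodesic of the optical metric: the null condition says that the time coordinate
runs at the rate `N ‖ẋ‖`, where `N = √(ℬ⁻¹ / 𝒜)` is a function of `u = m / r` only, and
`N = 1 + a u + (κ - a ^ 2 / 2) u ^ 2 + (κ₃ - a κ + a ^ 3 / 2) u ^ 3 + O(u ^ 4)` with `a = 1 + γ`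
(`PPNParameters.refractiveIndex_sub_isBigO`). Since the travel time is stationary along rays
(Fermat's principle), the path is needed to first order in the gravitational constant only, in order
to obtain the travel time to third order.

Split the position into the coordinate `s` along the unperturbed segment and the transverse part
`D + ω`, where `D` is the foot of the perpendicular from the centre, at distance `d`. Integrating the
transverse part of the spatial geodesic equation once, and using that `ω` vanishes at both ends,
gives `ω = t h(s) D + O(t ^ 2)`, together with its derivative, where `t` is the expansion parameter
and `h'' = - a m / (s ^ 2 + d ^ 2) ^ (3 / 2)` (`IsQuasiMinkowskianRay.transverse_isBigO`). In
`N ‖ẋ‖` the unknown second order part of `ω` enters through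
`t (h'' ṡ ⟪D, ω⟫ + h' ⟪D, ω̇⟫)`, up to `O(t ^ 4)` (`index_mul_speed_sub_isBigO`). This is the total
derivative of `t h' ⟪D, ω⟫`, which vanishes at both ends; so the terms of order two and three of the
travel time are integrals over the segment of explicit functions of `s`
(`IsQuasiMinkowskianRay.time_terms_eq`). Their antiderivatives are elementary; the angle between the
end points appears as a difference of arctangents, and the logarithms cancel.

Throughout, the statement that `f` is of order `k` reads `f =O[l] fun p => ε p ^ k`, for a small
quantity `ε`; along the ray, `ε` is the factor multiplying the gravitational constant, and `l` is
`rayFilter`, which makes all estimates uniform in the affine parameter.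
-/

noncomputable section

open Asymptotics

/-! ### Expansions in powers of a small quantity -/

section Orders

variable {α F : Type*} [NormedAddCommGroup F] {l : Filter α} {ε : α → ℝ}

theorem isBigO_pow_of_le (hε : Tendsto ε l (𝓝 0)) {j k : ℕ} (hjk : j ≤ k) {f : α → F}
    (hf : f =O[l] fun p => ε p ^ k) : f =O[l] fun p => ε p ^ j := by
  refine hf.trans ?_
  obtain ⟨i, rfl⟩ := Nat.exists_eq_add_of_le hjk
  have h1 : (fun p => ε p ^ i) =O[l] fun _ => (1 : ℝ) := by
    simpa using (hε.isBigO_one ℝ).pow i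
  simpa [pow_add] using (isBigO_refl (fun p => ε p ^ j) l).mul h1

theorem isBigO_pow_self (hε : Tendsto ε l (𝓝 0)) {j k : ℕ} (hjk : j ≤ k) :
    (fun p => ε p ^ k) =O[l] fun p => ε p ^ j :=
  isBigO_pow_of_le hε hjk (isBigO_refl _ _)

theorem isBigO_mul_pow {j k n : ℕ} {f g : α → ℝ} (hf : f =O[l] fun p => ε p ^ j)
    (hg : g =O[l] fun p => ε p ^ k) (h : j + k = n) :
    (fun p => f p * g p) =O[l] fun p => ε p ^ n := by
  subst h
  simpa [pow_add] using hf.mul hg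

theorem isBigO_smul_pow [NormedSpace ℝ F] {j k n : ℕ} {f : α → ℝ} {g : α → F}
    (hf : f =O[l] fun p => ε p ^ j)
    (hg : g =O[l] fun p => ε p ^ k) (h : j + k = n) :
    (fun p => f p • g p) =O[l] fun p => ε p ^ n := by
  subst h
  simpa [pow_add] using hf.smul hg

theorem isBigO_inner_pow {G : Type*} [NormedAddCommGroup G] [InnerProductSpace ℝ G]
    {j k n : ℕ} {f g : α → G} (hf : f =O[l] fun p => ε p ^ j)
    (hg : g =O[l] fun p => ε p ^ k) (h : j + k = n) :
    (fun p => inner ℝ (f p) (g p)) =O[l] fun p => ε p ^ n := by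
  subst h
  refine IsBigO.trans (g := fun p => ‖f p‖ * ‖g p‖) ?_ ?_
  · refine isBigO_of_le _ fun p => ?_
    rw [norm_mul, norm_norm, norm_norm]
    exact norm_inner_le_norm (𝕜 := ℝ) _ _
  · simpa [pow_add] using hf.norm_left.mul hg.norm_left

theorem isBigO_const_pow_zero (c : F) : (fun _ => c) =O[l] fun p => ε p ^ 0 := by
  simpa using isBigO_const_const c (one_ne_zero (α := ℝ)) l

theorem isBigO_pow_zero_iff {f : α → F} :
    (f =O[l] fun p => ε p ^ 0) ↔ f =O[l] fun _ => (1 : ℝ) := by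
  simp

theorem isBigO_const_mul_pow {k : ℕ} {f : α → ℝ} (c : ℝ) (hf : f =O[l] fun p => ε p ^ k) :
    (fun p => c * f p) =O[l] fun p => ε p ^ k :=
  hf.const_mul_left c

theorem tendsto_zero_of_isBigO (hε : Tendsto ε l (𝓝 0)) {f : α → F}
    (hf : f =O[l] fun p => ε p ^ 1) : Tendsto f l (𝓝 0) := by
  refine hf.trans_tendsto ?_
  simpa using hε

/-- An approximate square root `p` of `f`, bounded below by a positive constant, is as close to
`√f` as `p ^ 2` is to `f`. -/
theorem sqrt_sub_isBigO {f p : α → ℝ} {g : α → ℝ} {δ : ℝ} (hδ : 0 < δ)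
    (hf : ∀ᶠ x in l, 0 ≤ f x) (hp : ∀ᶠ x in l, δ ≤ p x)
    (h : (fun x => f x - p x ^ 2) =O[l] g) : (fun x => √(f x) - p x) =O[l] g := by
  refine IsBigO.trans (IsBigO.of_bound δ⁻¹ ?_) h
  filter_upwards [hf, hp] with x h1 h2
  have h3 : f x - p x ^ 2 = (√(f x) - p x) * (√(f x) + p x) := by
    have := Real.sq_sqrt h1
    linear_combination -this
  have h4 : δ ≤ √(f x) + p x := by linarith [Real.sqrt_nonneg (f x)]
  rw [h3, norm_mul, Real.norm_eq_abs (√(f x) + p x), abs_of_pos (hδ.trans_le h4),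
    inv_mul_eq_div, le_div_iff₀ hδ]
  exact mul_le_mul_of_nonneg_left h4 (norm_nonneg _)

end Orders

/-- A polynomial of degree at most three that is `O(t ^ 4)` to the right of `0` vanishes. -/
theorem eq_zero_of_isBigO_pow_four {c₀ c₁ c₂ c₃ : ℝ}
    (h : (fun t : ℝ => c₀ + c₁ * t + c₂ * t ^ 2 + c₃ * t ^ 3) =O[𝓝[>] 0] fun t => t ^ 4) :
    c₀ = 0 ∧ c₁ = 0 ∧ c₂ = 0 ∧ c₃ = 0 := by
  have hε : Tendsto (fun t : ℝ => t) (𝓝[>] 0) (𝓝 0) := tendsto_id.mono_left nhdsWithin_le_nhds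
  -- a constant that is `O(t ^ (n + 1))` relative to `t ^ n` vanishes
  have key : ∀ (n : ℕ) (c : ℝ), ((fun t : ℝ => c * t ^ n) =O[𝓝[>] 0] fun t => t ^ (n + 1)) →
      c = 0 := by
    intro n c hc
    obtain ⟨K, hK⟩ := hc.bound
    have h1 : ∀ᶠ t : ℝ in 𝓝[>] 0, |c| ≤ K * t := by
      filter_upwards [hK, self_mem_nhdsWithin] with t ht ht0
      have ht0 : 0 < t := ht0
      have hp : 0 < t ^ n := by positivity
      rw [norm_mul, Real.norm_eq_abs, Real.norm_of_nonneg hp.le,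
        Real.norm_of_nonneg (by positivity), pow_succ, mul_comm (t ^ n) t, ← mul_assoc] at ht
      exact le_of_mul_le_mul_right ht hp
    have h2 : Tendsto (fun t : ℝ => K * t) (𝓝[>] 0) (𝓝 0) := by simpa using hε.const_mul K
    have h3 := ge_of_tendsto h2 h1
    exact abs_nonpos_iff.1 h3
  have hm : ∀ (n k : ℕ) (c : ℝ), k ≤ n → (fun t : ℝ => c * t ^ n) =O[𝓝[>] 0] fun t => t ^ k :=
    fun n k c hk => isBigO_const_mul_pow c (isBigO_pow_self hε hk)
  have e0 : c₀ = 0 := key 0 c₀ <| by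
    refine ((isBigO_pow_of_le hε (j := 0 + 1) (by norm_num) h).sub
      (((hm 1 (0 + 1) c₁ (by norm_num)).add (hm 2 (0 + 1) c₂ (by norm_num))).add
        (hm 3 (0 + 1) c₃ (by norm_num)))).congr_left fun t => by ring
  subst e0
  have e1 : c₁ = 0 := key 1 c₁ <| by
    refine ((isBigO_pow_of_le hε (j := 1 + 1) (by norm_num) h).sub
      ((hm 2 (1 + 1) c₂ (by norm_num)).add
        (hm 3 (1 + 1) c₃ (by norm_num)))).congr_left fun t => by ring
  subst e1
  have e2 : c₂ = 0 := key 2 c₂ <| by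
    refine ((isBigO_pow_of_le hε (j := 2 + 1) (by norm_num) h).sub
        (hm 3 (2 + 1) c₃ (by norm_num))).congr_left fun t => by ring
  subst e2
  exact ⟨rfl, rfl, rfl, key 3 c₃ (h.congr_left fun t => by ring)⟩

/-! ### The metric potentials as power series -/

/-- The sum of the power series with coefficients `a`. -/
def powSum (a : ℕ → ℝ) (u : ℝ) : ℝ := ∑' n : ℕ, a n * u ^ n

theorem hasFPowerSeriesAt_powSum {a : ℕ → ℝ} {C q : ℝ} (hq : 0 < q)
    (ha : ∀ n, |a n| * q ^ n ≤ C) :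
    HasFPowerSeriesAt (powSum a) (FormalMultilinearSeries.ofScalars ℝ a) 0 := by
  have hr : 0 < (FormalMultilinearSeries.ofScalars ℝ a : FormalMultilinearSeries ℝ ℝ ℝ).radius := by
    refine lt_of_lt_of_le ?_ (FormalMultilinearSeries.le_radius_of_bound _ C
      (r := ⟨q, hq.le⟩) fun n => ?_)
    · exact ENNReal.coe_pos.2 (NNReal.coe_pos.1 hq)
    · rw [FormalMultilinearSeries.ofScalars_norm]
      exact ha n
  have h := (FormalMultilinearSeries.hasFPowerSeriesOnBall _ hr).hasFPowerSeriesAt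
  have e : (FormalMultilinearSeries.ofScalars ℝ a : FormalMultilinearSeries ℝ ℝ ℝ).sum
      = powSum a := by
    funext u
    have := FormalMultilinearSeries.ofScalars_sum_eq (E := ℝ) a u
    simpa [FormalMultilinearSeries.ofScalarsSum, powSum] using this
  rwa [e] at h

theorem powSum_sub_cubic_isBigO {a : ℕ → ℝ} {C q : ℝ} (hq : 0 < q)
    (ha : ∀ n, |a n| * q ^ n ≤ C) :
    (fun u => powSum a u - (a 0 + a 1 * u + a 2 * u ^ 2 + a 3 * u ^ 3)) =O[𝓝 0]
      fun u => u ^ 4 := by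
  have h := (hasFPowerSeriesAt_powSum hq ha).isBigO_sub_partialSum_pow 4
  have h2 : (fun u : ℝ => ‖u‖ ^ 4) =O[𝓝 0] fun u : ℝ => u ^ 4 :=
    isBigO_of_le _ fun u => by simp
  refine (h.trans h2).congr_left fun u => ?_
  simp [FormalMultilinearSeries.partialSum, Finset.sum_range_succ,
    FormalMultilinearSeries.ofScalars]

theorem differentiableAt_powSum {a : ℕ → ℝ} {C q : ℝ} (hq : 0 < q)
    (ha : ∀ n, |a n| * q ^ n ≤ C) : ∀ᶠ u in 𝓝 0, DifferentiableAt ℝ (powSum a) u := by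
  filter_upwards [(hasFPowerSeriesAt_powSum hq ha).analyticAt.eventually_analyticAt] with u hu
  exact hu.differentiableAt

theorem deriv_powSum_sub_isBigO {a : ℕ → ℝ} {C q : ℝ} (hq : 0 < q)
    (ha : ∀ n, |a n| * q ^ n ≤ C) :
    (fun u => deriv (powSum a) u - a 1) =O[𝓝 0] fun u => u ^ 1 := by
  have h := hasFPowerSeriesAt_powSum hq ha
  have h1 : deriv (powSum a) 0 = a 1 := by
    rw [h.deriv]; simp [FormalMultilinearSeries.ofScalars]
  have h2 := h.analyticAt.deriv.differentiableAt.isBigO_sub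
  simpa [h1] using h2

namespace PPNParameters

theorem potA_eq_powSum (P : PPNParameters) (m r : ℝ) : P.potA m r = powSum P.coeffA (m / r) := by
  simp [potA, powSum, div_pow]

theorem potBinv_eq_powSum (P : PPNParameters) (m r : ℝ) :
    P.potBinv m r = powSum P.coeffBinv (m / r) := by
  simp [potBinv, powSum, div_pow]

theorem IsRegularOutside.exists_bound {P : PPNParameters} {m rh : ℝ} (hm : 0 < m) (hrh : 0 < rh)
    (h : P.IsRegularOutside m rh) : ∃ C q : ℝ, 0 < q ∧ (∀ n, |P.coeffA n| * q ^ n ≤ C) ∧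
      ∀ n, |P.coeffBinv n| * q ^ n ≤ C := by
  have hr : rh < rh + 1 := by linarith
  have hq : 0 < m / (rh + 1) := by positivity
  have key : ∀ a : ℕ → ℝ, (Summable fun n : ℕ => a n * (m ^ n / (rh + 1) ^ n)) →
      ∃ C, ∀ n, |a n| * (m / (rh + 1)) ^ n ≤ C := by
    intro a ha
    obtain ⟨C, hC⟩ := ha.tendsto_atTop_zero.norm.bddAbove_range
    refine ⟨C, fun n => le_trans (le_of_eq ?_) (hC ⟨n, rfl⟩)⟩
    simp only []
    rw [norm_mul, ← div_pow, norm_pow, Real.norm_of_nonneg hq.le, Real.norm_eq_abs]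
  obtain ⟨C₁, h₁⟩ := key _ (h.summable_A _ hr)
  obtain ⟨C₂, h₂⟩ := key _ (h.summable_Binv _ hr)
  exact ⟨max C₁ C₂, _, hq, fun n => (h₁ n).trans (le_max_left _ _),
    fun n => (h₂ n).trans (le_max_right _ _)⟩

/-- The index of refraction `√(ℬ⁻¹ / 𝒜)` as a function of `u = m / r`. -/
def refractiveIndex (P : PPNParameters) (u : ℝ) : ℝ :=
  √(powSum P.coeffBinv u / powSum P.coeffA u)

theorem tendsto_powSum_coeffA {P : PPNParameters} {C q : ℝ} (hq : 0 < q)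
    (hA : ∀ n, |P.coeffA n| * q ^ n ≤ C) : Tendsto (powSum P.coeffA) (𝓝 0) (𝓝 1) := by
  have h := (hasFPowerSeriesAt_powSum hq hA).analyticAt.continuousAt.tendsto
  have h0 : powSum P.coeffA 0 = 1 := by
    rw [powSum, tsum_eq_single 0 (fun n hn => by simp [hn])]; simp [coeffA]
  rwa [h0] at h

theorem tendsto_powSum_coeffBinv {P : PPNParameters} {C q : ℝ} (hq : 0 < q)
    (hA : ∀ n, |P.coeffBinv n| * q ^ n ≤ C) : Tendsto (powSum P.coeffBinv) (𝓝 0) (𝓝 1) := by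
  have h := (hasFPowerSeriesAt_powSum hq hA).analyticAt.continuousAt.tendsto
  have h0 : powSum P.coeffBinv 0 = 1 := by
    rw [powSum, tsum_eq_single 0 (fun n hn => by simp [hn])]; simp [coeffBinv]
  rwa [h0] at h

/-- Expansion of the index of refraction; it is where the combinations `κ` and `κ₃` of the
post-Newtonian parameters come from. -/
theorem refractiveIndex_sub_isBigO {P : PPNParameters} {C q : ℝ} (hq : 0 < q)
    (hA : ∀ n, |P.coeffA n| * q ^ n ≤ C) (hB : ∀ n, |P.coeffBinv n| * q ^ n ≤ C) :
    (fun u => P.refractiveIndex u - (1 + (1 + P.gamma) * u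
      + (P.kappa - (1 + P.gamma) ^ 2 / 2) * u ^ 2
      + (P.kappa3 - (1 + P.gamma) * P.kappa + (1 + P.gamma) ^ 3 / 2) * u ^ 3)) =O[𝓝 0]
      fun u => u ^ 4 := by
  have tA := tendsto_powSum_coeffA hq hA
  have tB := tendsto_powSum_coeffBinv hq hB
  have eA : ∀ᶠ u in 𝓝 0, 1 / 2 < powSum P.coeffA u := tA.eventually_const_lt (by norm_num)
  have eB : ∀ᶠ u in 𝓝 0, 1 / 2 < powSum P.coeffBinv u := tB.eventually_const_lt (by norm_num)
  have oA := powSum_sub_cubic_isBigO hq hA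
  have oB := powSum_sub_cubic_isBigO hq hB
  simp only [coeffA, coeffBinv] at oA oB
  set a := 1 + P.gamma with ha
  set b := P.kappa - a ^ 2 / 2 with hb
  set c := P.kappa3 - a * P.kappa + a ^ 3 / 2 with hc
  have cN : Tendsto (fun u : ℝ => 1 + a * u + b * u ^ 2 + c * u ^ 3) (𝓝 0) (𝓝 1) := by
    have : Continuous fun u : ℝ => 1 + a * u + b * u ^ 2 + c * u ^ 3 := by fun_prop
    simpa using this.tendsto 0
  refine sqrt_sub_isBigO (δ := 1 / 2) (by norm_num) ?_ ?_ ?_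
  · filter_upwards [eA, eB] with u h1 h2
    exact div_nonneg (by linarith) (by linarith)
  · exact (cN.eventually_const_lt (by norm_num : (1 : ℝ) / 2 < 1)).mono fun u hu => hu.le
  -- it suffices to compare `ℬ⁻¹` with `𝒜` times the square of the polynomial
  have h1 : (fun u : ℝ => powSum P.coeffBinv u - powSum P.coeffA u *
      (1 + a * u + b * u ^ 2 + c * u ^ 3) ^ 2) =O[𝓝 0] fun u => u ^ 4 := by
    have h3 : (fun u : ℝ => (1 + a * u + b * u ^ 2 + c * u ^ 3) ^ 2) =O[𝓝 0]
        fun u : ℝ => u ^ 0 := by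
      rw [isBigO_pow_zero_iff]; exact (cN.pow 2).isBigO_one ℝ
    have h4 := oB.sub (isBigO_mul_pow oA h3 (rfl : 4 + 0 = 4))
    -- the quotient by `u ^ 4` of the polynomial part
    have h5 : (fun u : ℝ => u ^ 4 * (-(2 * a * c + b ^ 2) - 2 * b * c * u - c ^ 2 * u ^ 2
        + 2 * (2 * c + 2 * a * b + (2 * a * c + b ^ 2) * u + 2 * b * c * u ^ 2 + c ^ 2 * u ^ 3)
        - 2 * P.beta * (2 * b + a ^ 2 + (2 * c + 2 * a * b) * u + (2 * a * c + b ^ 2) * u ^ 2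
          + 2 * b * c * u ^ 3 + c ^ 2 * u ^ 4)
        + 3 / 2 * P.betaN 3 * (2 * a + (2 * b + a ^ 2) * u + (2 * c + 2 * a * b) * u ^ 2
          + (2 * a * c + b ^ 2) * u ^ 3 + 2 * b * c * u ^ 4 + c ^ 2 * u ^ 5))) =O[𝓝 0]
        fun u => u ^ 4 := by
      refine isBigO_mul_pow (isBigO_refl _ _) (k := 0) ?_ rfl
      rw [isBigO_pow_zero_iff]
      refine Tendsto.isBigO_one ℝ (Continuous.tendsto ?_ 0)
      fun_prop
    refine (h4.add h5).congr_left fun u => ?_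
    simp only [ha, hb, hc, kappa, kappa3]
    ring
  have h2 : (fun u : ℝ => (powSum P.coeffA u)⁻¹) =O[𝓝 0] fun u : ℝ => u ^ 0 := by
    rw [isBigO_pow_zero_iff]; exact (tA.inv₀ one_ne_zero).isBigO_one ℝ
  refine (isBigO_mul_pow h1 h2 rfl).congr' ?_ EventuallyEq.rfl
  filter_upwards [eA] with u hu
  have : powSum P.coeffA u ≠ 0 := by linarith
  field_simp

end PPNParameters

/-! ### The rate of the time coordinate along a nearly straight ray -/

section Pointwise

variable {α : Type*} {l : Filter α} {ε : α → ℝ}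

theorem inv_sqrt_add_sub_isBigO (hε : Tendsto ε l (𝓝 0)) {x q : α → ℝ} {δ M : ℝ} (hδ : 0 < δ)
    (hx : ∀ p, δ ≤ x p) (hM : ∀ᶠ p in l, x p ≤ M) (hq : q =O[l] fun p => ε p ^ 1) :
    (fun p => (√(x p + q p))⁻¹ - ((√(x p))⁻¹ - q p * (√(x p))⁻¹ ^ 3 / 2
      + 3 * q p ^ 2 * (√(x p))⁻¹ ^ 5 / 8)) =O[l] fun p => ε p ^ 3 := by
  have hq0 := tendsto_zero_of_isBigO hε hq
  set i : α → ℝ := fun p => (√(x p))⁻¹ with hi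
  have hx0 : ∀ p, 0 < √(x p) := fun p => Real.sqrt_pos.2 (hδ.trans_le (hx p))
  have hi2 : ∀ p, x p * i p ^ 2 = 1 := by
    intro p
    have h1 := hx0 p
    have h2 := Real.sq_sqrt (hδ.le.trans (hx p))
    simp only [hi]
    rw [inv_pow, h2]
    exact mul_inv_cancel₀ (hδ.trans_le (hx p)).ne'
  have ib : i =O[l] fun p => ε p ^ 0 := by
    rw [isBigO_pow_zero_iff]
    refine IsBigO.of_bound (√δ)⁻¹ (Eventually.of_forall fun p => ?_)
    rw [norm_one, mul_one, Real.norm_of_nonneg (inv_nonneg.2 (hx0 p).le)]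
    exact inv_anti₀ (Real.sqrt_pos.2 hδ) (Real.sqrt_le_sqrt (hx p))
  have i2b : (fun p => i p ^ 2) =O[l] fun p => ε p ^ 0 := by
    simpa [sq] using isBigO_mul_pow ib ib rfl
  have hs : ∀ᶠ p in l, δ / 2 < x p + q p := by
    filter_upwards [hq0.eventually_const_lt (show -(δ / 2) < 0 by linarith)] with p hp
    linarith [hx p]
  have t1 : (fun p => q p * i p ^ 2) =O[l] fun p => ε p ^ 1 := isBigO_mul_pow hq i2b rfl
  have t2 : (fun p => (q p * i p ^ 2) ^ 2) =O[l] fun p => ε p ^ 2 := by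
    simpa [sq] using isBigO_mul_pow t1 t1 rfl
  have t3 : (fun p => (q p * i p ^ 2) ^ 3) =O[l] fun p => ε p ^ 3 :=
    (isBigO_mul_pow t2 t1 rfl).congr_left fun p => by ring
  have hlow : ∀ᶠ p in l, (√(M + δ))⁻¹ / 2 ≤
      i p - q p * i p ^ 3 / 2 + 3 * q p ^ 2 * i p ^ 5 / 8 := by
    filter_upwards [hM, (tendsto_zero_of_isBigO hε t1).eventually_lt_const
      (show (0 : ℝ) < 1 by norm_num)] with p h1 h2
    have h3 : (√(M + δ))⁻¹ ≤ i p :=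
      inv_anti₀ (hx0 p) (Real.sqrt_le_sqrt (by linarith))
    have h4 : i p - q p * i p ^ 3 / 2 + 3 * q p ^ 2 * i p ^ 5 / 8
        = i p * (1 - (q p * i p ^ 2) / 2 + 3 * (q p * i p ^ 2) ^ 2 / 8) := by ring
    have h5 : 0 < i p := inv_pos.2 (hx0 p)
    rw [h4]
    have h6 : (1 : ℝ) / 2 ≤ 1 - (q p * i p ^ 2) / 2 + 3 * (q p * i p ^ 2) ^ 2 / 8 := by
      nlinarith [sq_nonneg (q p * i p ^ 2)]
    calc (√(M + δ))⁻¹ / 2 ≤ i p * (1 / 2) := by linarith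
      _ ≤ _ := mul_le_mul_of_nonneg_left h6 h5.le
  by_cases hl : l = ⊥
  · exact IsBigO.of_bound 1 (by simp [hl])
  have : NeBot l := ⟨hl⟩
  have hMpos : 0 < M + δ := by
    obtain ⟨p, hp⟩ := hM.exists
    linarith [hx p]
  have key : (fun p => √((x p + q p)⁻¹) - (i p - q p * i p ^ 3 / 2
      + 3 * q p ^ 2 * i p ^ 5 / 8)) =O[l] fun p => ε p ^ 3 := by
    refine sqrt_sub_isBigO (δ := (√(M + δ))⁻¹ / 2) (by positivity) ?_ hlow ?_
    · filter_upwards [hs] with p hp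
      exact inv_nonneg.2 (by linarith)
    · have hb : (fun p => (x p + q p)⁻¹) =O[l] fun p => ε p ^ 0 := by
        rw [isBigO_pow_zero_iff]
        refine IsBigO.of_bound (δ / 2)⁻¹ ?_
        filter_upwards [hs] with p hp
        rw [norm_one, mul_one, Real.norm_of_nonneg (inv_nonneg.2 (by linarith))]
        exact inv_anti₀ (by linarith) hp.le
      have hc : (fun p => -(5 / 8) * (q p * i p ^ 2) ^ 3 + (15 / 64 * (q p * i p ^ 2) ^ 3) *
          (q p * i p ^ 2) - (9 / 64 * (q p * i p ^ 2) ^ 3) * (q p * i p ^ 2) ^ 2)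
          =O[l] fun p => ε p ^ 3 :=
        ((t3.const_mul_left _).add (isBigO_pow_of_le hε (by norm_num)
          (isBigO_mul_pow (t3.const_mul_left _) t1 rfl))).sub
          (isBigO_pow_of_le hε (by norm_num) (isBigO_mul_pow (t3.const_mul_left _) t2 rfl))
      refine (isBigO_mul_pow hc hb (rfl : 3 + 0 = 3)).congr' ?_ EventuallyEq.rfl
      filter_upwards [hs] with p hp
      have h1 : x p + q p ≠ 0 := by linarith
      have h2 := hi2 p
      rw [← div_eq_mul_inv, div_eq_iff h1, sub_mul, inv_mul_cancel₀ h1]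
      linear_combination (-1 + (q p * i p ^ 2) - (q p * i p ^ 2) ^ 2
        + 3 / 8 * (q p * i p ^ 2) ^ 3 - 9 / 64 * (q p * i p ^ 2) ^ 4) * (-h2)
  exact key.congr_left fun p => by rw [Real.sqrt_inv]

theorem sqrt_sq_add_sub_isBigO {v W : α → ℝ} {δ : ℝ} (hδ : 0 < δ)
    (hv : ∀ᶠ p in l, δ ≤ v p) (hW0 : ∀ p, 0 ≤ W p) (hW : W =O[l] fun p => ε p ^ 2) :
    (fun p => √(v p ^ 2 + W p) - (v p + W p / (2 * v p))) =O[l] fun p => ε p ^ 4 := by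
  refine sqrt_sub_isBigO hδ (Eventually.of_forall fun p => by have := hW0 p; positivity) ?_ ?_
  · filter_upwards [hv] with p hp
    have h0 : 0 < v p := hδ.trans_le hp
    have := hW0 p
    have : 0 ≤ W p / (2 * v p) := by positivity
    linarith
  · have hb : (fun p => (v p)⁻¹) =O[l] fun p => ε p ^ 0 := by
      rw [isBigO_pow_zero_iff]
      refine IsBigO.of_bound δ⁻¹ ?_
      filter_upwards [hv] with p hp
      rw [norm_one, mul_one, Real.norm_of_nonneg (inv_nonneg.2 (hδ.le.trans hp))]
      exact inv_anti₀ hδ hp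
    have h2 := isBigO_mul_pow (isBigO_mul_pow hW hW (rfl : 2 + 2 = 4))
      (isBigO_mul_pow hb hb (rfl : 0 + 0 = 0)) (rfl : 4 + 0 = 4)
    refine (h2.const_mul_left (-(1 / 4))).congr' ?_ EventuallyEq.rfl
    filter_upwards [hv] with p hp
    have h0 : v p ≠ 0 := (hδ.trans_le hp).ne'
    field_simp
    ring

/-- Third order expansion of `N(m / r) |ẋ|` along a ray whose transverse displacement `ω` from a
straight line is known to first order only. Here `s`, `v` are the longitudinal coordinate and
velocity, `d` is the distance of the line from the centre, `w`, `W`, `wv`, `Wv` stand for `⟪D, ω⟫`,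
`‖ω‖ ^ 2`, `⟪D, ω̇⟫`, `‖ω̇‖ ^ 2` (with `D` the foot of the perpendicular), and `ω` is
`ε h D + O(ε ^ 2)`, `ω̇` is `ε h' v D + O(ε ^ 2)`. The unknown second order part of `ω` enters only
through `w` and `wv`. -/
theorem index_mul_speed_sub_isBigO (hε : Tendsto ε l (𝓝 0)) {N : ℝ → ℝ} {a b c m d δ M : ℝ}
    (hN : (fun u => N u - (1 + a * u + b * u ^ 2 + c * u ^ 3)) =O[𝓝 0] fun u => u ^ 4)
    (hd : 0 < d) (hδ : 0 < δ) {s v w W wv Wv h h' : α → ℝ}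
    (hs : ∀ᶠ p in l, |s p| ≤ M) (hv : ∀ᶠ p in l, δ ≤ v p)
    (hvb : v =O[l] fun p => ε p ^ 0) (hb : h =O[l] fun p => ε p ^ 0)
    (hb' : h' =O[l] fun p => ε p ^ 0)
    (hw : (fun p => w p - ε p * (h p * d ^ 2)) =O[l] fun p => ε p ^ 2)
    (hW : (fun p => W p - ε p ^ 2 * (h p ^ 2 * d ^ 2)) =O[l] fun p => ε p ^ 3)
    (hwv : (fun p => wv p - ε p * (h' p * v p * d ^ 2)) =O[l] fun p => ε p ^ 2)
    (hWv : (fun p => Wv p - (2 * ε p * (h' p * v p) * wv p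
      - ε p ^ 2 * ((h' p * v p) ^ 2 * d ^ 2))) =O[l] fun p => ε p ^ 4)
    (hWv0 : ∀ p, 0 ≤ Wv p) :
    (fun p => N (ε p * m / √(s p ^ 2 + d ^ 2 + (2 * w p + W p))) * √(v p ^ 2 + Wv p)
      - (v p * (1 + ε p * (a * m * (√(s p ^ 2 + d ^ 2))⁻¹)
          - ε p * (a * m * (√(s p ^ 2 + d ^ 2))⁻¹ ^ 3 * w p)
          + ε p ^ 2 * (b * m ^ 2 * (√(s p ^ 2 + d ^ 2))⁻¹ ^ 2 - h' p ^ 2 * d ^ 2 / 2)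
          + ε p ^ 3 * (c * m ^ 3 * (√(s p ^ 2 + d ^ 2))⁻¹ ^ 3
            - 2 * b * m ^ 2 * h p * d ^ 2 * (√(s p ^ 2 + d ^ 2))⁻¹ ^ 4
            + a * m * h p ^ 2 * d ^ 2 * (-(√(s p ^ 2 + d ^ 2))⁻¹ ^ 3 / 2
              + 3 / 2 * d ^ 2 * (√(s p ^ 2 + d ^ 2))⁻¹ ^ 5)
            + a * m * h' p ^ 2 * d ^ 2 * (√(s p ^ 2 + d ^ 2))⁻¹ / 2))
        + ε p * (h' p * wv p))) =O[l] fun p => ε p ^ 4 := by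
  have mono : ∀ {j k : ℕ} {f : α → ℝ}, j ≤ k → (f =O[l] fun p => ε p ^ k) →
      f =O[l] fun p => ε p ^ j := fun h1 h2 => isBigO_pow_of_le hε h1 h2
  have E : ∀ k, (fun p => ε p ^ k) =O[l] fun p => ε p ^ k := fun k => isBigO_refl _ _
  have E1 : ε =O[l] fun p => ε p ^ 1 := by simpa using isBigO_refl ε l
  set i : α → ℝ := fun p => (√(s p ^ 2 + d ^ 2))⁻¹ with hi
  have hx : ∀ p, d ^ 2 ≤ s p ^ 2 + d ^ 2 := fun p => by nlinarith [sq_nonneg (s p)]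
  have hd2 : 0 < d ^ 2 := by positivity
  have ib : i =O[l] fun p => ε p ^ 0 := by
    rw [isBigO_pow_zero_iff]
    refine IsBigO.of_bound (√(d ^ 2))⁻¹ (Eventually.of_forall fun p => ?_)
    rw [norm_one, mul_one, Real.norm_of_nonneg (by positivity)]
    exact inv_anti₀ (Real.sqrt_pos.2 hd2) (Real.sqrt_le_sqrt (hx p))
  have i2 : (fun p => i p ^ 2) =O[l] fun p => ε p ^ 0 := by
    simpa [sq] using isBigO_mul_pow ib ib rfl
  have i3 : (fun p => i p ^ 3) =O[l] fun p => ε p ^ 0 :=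
    (isBigO_mul_pow i2 ib rfl).congr_left fun p => by ring
  have i5 : (fun p => i p ^ 5) =O[l] fun p => ε p ^ 0 :=
    (isBigO_mul_pow i3 i2 rfl).congr_left fun p => by ring
  have h2b : (fun p => h p ^ 2) =O[l] fun p => ε p ^ 0 := by
    simpa [sq] using isBigO_mul_pow hb hb rfl
  have h'2b : (fun p => h' p ^ 2) =O[l] fun p => ε p ^ 0 := by
    simpa [sq] using isBigO_mul_pow hb' hb' rfl
  -- orders of the transverse quantities
  have w1 : w =O[l] fun p => ε p ^ 1 :=
    ((mono (by norm_num) hw).add (isBigO_mul_pow E1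
      (hb.const_mul_left (d ^ 2)) (rfl : 1 + 0 = 1))).congr_left fun p => by ring
  have W2 : W =O[l] fun p => ε p ^ 2 :=
    ((mono (by norm_num) hW).add (isBigO_mul_pow (E 2)
      (h2b.const_mul_left (d ^ 2)) (rfl : 2 + 0 = 2))).congr_left fun p => by ring
  have hvv : (fun p => h' p * v p) =O[l] fun p => ε p ^ 0 := isBigO_mul_pow hb' hvb rfl
  have wv1 : wv =O[l] fun p => ε p ^ 1 :=
    ((mono (by norm_num) hwv).add (isBigO_mul_pow E1
      (hvv.const_mul_left (d ^ 2)) (rfl : 1 + 0 = 1))).congr_left fun p => by ring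
  have Wv2 : Wv =O[l] fun p => ε p ^ 2 := by
    have e1 := isBigO_mul_pow (isBigO_mul_pow (E1.const_mul_left 2) hvv (rfl : 1 + 0 = 1)) wv1
      (rfl : 1 + 1 = 2)
    have e2 := isBigO_mul_pow (E 2) ((isBigO_mul_pow hvv hvv
      (rfl : 0 + 0 = 0)).const_mul_left (d ^ 2)) (rfl : 2 + 0 = 2)
    exact ((mono (by norm_num) hWv).add (e1.sub e2)).congr_left fun p => by ring
  -- expansion of `1 / r`
  set q : α → ℝ := fun p => 2 * w p + W p with hq
  have q1 : q =O[l] fun p => ε p ^ 1 := (w1.const_mul_left 2).add (mono (by norm_num) W2)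
  have q' : (fun p => q p - 2 * (ε p * (h p * d ^ 2))) =O[l] fun p => ε p ^ 2 :=
    ((hw.const_mul_left 2).add W2).congr_left fun p => by simp only [hq]; ring
  have εh : (fun p => ε p * (h p * d ^ 2)) =O[l] fun p => ε p ^ 1 :=
    (isBigO_mul_pow E1 (hb.const_mul_left (d ^ 2)) (rfl : 1 + 0 = 1)).congr_left
      fun p => by ring
  have qq : (fun p => q p ^ 2 - 4 * (ε p * (h p * d ^ 2)) ^ 2) =O[l] fun p => ε p ^ 3 :=
    (isBigO_mul_pow q' (q1.add (εh.const_mul_left 2)) (rfl : 2 + 1 = 3)).congr_left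
      fun p => by ring
  set r' : α → ℝ := fun p => (√(s p ^ 2 + d ^ 2 + q p))⁻¹ with hr'
  have hr0 : (fun p => r' p - (i p - q p * i p ^ 3 / 2 + 3 * q p ^ 2 * i p ^ 5 / 8)) =O[l]
      fun p => ε p ^ 3 := by
    refine inv_sqrt_add_sub_isBigO hε hd2 hx (M := M ^ 2 + d ^ 2) ?_ q1
    filter_upwards [hs] with p hp
    have := sq_le_sq' (by linarith [(abs_le.1 hp).1]) (abs_le.1 hp).2
    linarith
  have hr3 : (fun p => r' p - (i p - w p * i p ^ 3 + ε p ^ 2 * (h p ^ 2 * d ^ 2 *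
      (-i p ^ 3 / 2 + 3 / 2 * d ^ 2 * i p ^ 5)))) =O[l] fun p => ε p ^ 3 := by
    have e1 := isBigO_mul_pow hW (i3.const_mul_left (-(1 / 2))) (rfl : 3 + 0 = 3)
    have e2 := isBigO_mul_pow qq (i5.const_mul_left (3 / 8)) (rfl : 3 + 0 = 3)
    exact ((hr0.add e1).add e2).congr_left fun p => by simp only [hq]; ring
  have hr2 : (fun p => r' p - (i p - ε p * (h p * d ^ 2) * i p ^ 3)) =O[l]
      fun p => ε p ^ 2 := by
    have e1 := isBigO_mul_pow hw (i3.const_mul_left (-1)) (rfl : 2 + 0 = 2)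
    have e2 : (fun p => -i p ^ 3 / 2 + 3 / 2 * d ^ 2 * i p ^ 5) =O[l] fun p => ε p ^ 0 :=
      ((i3.const_mul_left (-(1 / 2))).add (i5.const_mul_left (3 / 2 * d ^ 2))).congr_left
        fun p => by ring
    have e3 := isBigO_mul_pow (E 2) (isBigO_mul_pow (h2b.const_mul_left (d ^ 2)) e2
      (rfl : 0 + 0 = 0)) (rfl : 2 + 0 = 2)
    exact (((mono (by norm_num) hr3).add e1).add e3).congr_left fun p => by ring
  have hr1 : (fun p => r' p - i p) =O[l] fun p => ε p ^ 1 :=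
    ((mono (by norm_num) hr2).sub (isBigO_mul_pow εh i3
      (rfl : 1 + 0 = 1))).congr_left fun p => by ring
  have rb : r' =O[l] fun p => ε p ^ 0 :=
    ((mono (by norm_num) hr1).add ib).congr_left fun p => by ring
  have hrr : (fun p => r' p ^ 2 - (i p ^ 2 - 2 * (ε p * (h p * d ^ 2)) * i p ^ 4)) =O[l]
      fun p => ε p ^ 2 := by
    have e1 := isBigO_mul_pow hr2 (rb.add ib) (rfl : 2 + 0 = 2)
    have e2 := isBigO_mul_pow (isBigO_mul_pow εh i3 (rfl : 1 + 0 = 1)) hr1 (rfl : 1 + 1 = 2)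
    exact (e1.sub e2).congr_left fun p => by ring
  have hrrr : (fun p => r' p ^ 3 - i p ^ 3) =O[l] fun p => ε p ^ 1 := by
    have e1 : (fun p => r' p ^ 2 + r' p * i p + i p ^ 2) =O[l] fun p => ε p ^ 0 := by
      refine (IsBigO.add ?_ (isBigO_mul_pow rb ib rfl)).add i2
      simpa [sq] using isBigO_mul_pow rb rb rfl
    exact (isBigO_mul_pow hr1 e1 (rfl : 1 + 0 = 1)).congr_left fun p => by ring
  -- expansion of the index of refraction
  have u1 : (fun p => ε p * m / √(s p ^ 2 + d ^ 2 + q p)) =O[l] fun p => ε p ^ 1 :=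
    (isBigO_mul_pow E1 (rb.const_mul_left m) (rfl : 1 + 0 = 1)).congr_left
      fun p => by simp only [hr']; ring
  have n0 := hN.comp_tendsto (tendsto_zero_of_isBigO hε u1)
  have u4 : (fun p => (ε p * m / √(s p ^ 2 + d ^ 2 + q p)) ^ 4) =O[l] fun p => ε p ^ 4 := by
    have := u1.pow 4
    simpa using this
  set n : α → ℝ := fun p => N (ε p * m / √(s p ^ 2 + d ^ 2 + q p)) with hn
  have n1 : (fun p => n p - (1 + a * (ε p * m * r' p) + b * (ε p * m * r' p) ^ 2
      + c * (ε p * m * r' p) ^ 3)) =O[l] fun p => ε p ^ 4 :=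
    (n0.trans u4).congr_left fun p => by simp only [hn, hr', Function.comp, div_eq_mul_inv]
  have n2 : (fun p => n p - (1 + ε p * (a * m * i p) - ε p * (a * m * i p ^ 3 * w p)
      + ε p ^ 2 * (b * m ^ 2 * i p ^ 2)
      + ε p ^ 3 * (c * m ^ 3 * i p ^ 3 - 2 * b * m ^ 2 * h p * d ^ 2 * i p ^ 4
            + a * m * h p ^ 2 * d ^ 2 * (-i p ^ 3 / 2 + 3 / 2 * d ^ 2 * i p ^ 5)))) =O[l]
      fun p => ε p ^ 4 := by
    have e1 := isBigO_mul_pow (E1.const_mul_left (a * m)) hr3 (rfl : 1 + 3 = 4)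
    have e2 := isBigO_mul_pow ((E 2).const_mul_left (b * m ^ 2)) hrr (rfl : 2 + 2 = 4)
    have e3 := isBigO_mul_pow ((E 3).const_mul_left (c * m ^ 3)) hrrr (rfl : 3 + 1 = 4)
    exact (((n1.add e1).add e2).add e3).congr_left fun p => by ring
  have n3 : (fun p => n p - (1 + ε p * (a * m * i p))) =O[l] fun p => ε p ^ 2 := by
    have e1 := isBigO_mul_pow (isBigO_mul_pow (E1.const_mul_left (-(a * m))) i3
      (rfl : 1 + 0 = 1)) w1 (rfl : 1 + 1 = 2)
    have e2 := isBigO_mul_pow ((E 2).const_mul_left (b * m ^ 2)) i2 (rfl : 2 + 0 = 2)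
    have e3 : (fun p => c * m ^ 3 * i p ^ 3 - 2 * b * m ^ 2 * h p * d ^ 2 * i p ^ 4
        + a * m * h p ^ 2 * d ^ 2 * (-i p ^ 3 / 2 + 3 / 2 * d ^ 2 * i p ^ 5)) =O[l]
        fun p => ε p ^ 0 := by
      have f1 := i3.const_mul_left (c * m ^ 3)
      have f2 := isBigO_mul_pow (hb.const_mul_left (2 * b * m ^ 2 * d ^ 2))
        (isBigO_mul_pow i2 i2 (rfl : 0 + 0 = 0)) (rfl : 0 + 0 = 0)
      have f3 := isBigO_mul_pow (h2b.const_mul_left (a * m * d ^ 2))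
        ((i3.const_mul_left (-(1 / 2))).add (i5.const_mul_left (3 / 2 * d ^ 2)))
        (rfl : 0 + 0 = 0)
      exact ((f1.sub f2).add f3).congr_left fun p => by ring
    have e4 := mono (show 2 ≤ 3 by norm_num) (isBigO_mul_pow (E 3) e3 (rfl : 3 + 0 = 3))
    exact ((((mono (by norm_num) n2).add e1).add e2).add e4).congr_left fun p => by ring
  have nb : n =O[l] fun p => ε p ^ 0 := by
    have e1 := mono (show 0 ≤ 1 by norm_num) (isBigO_mul_pow E1 (ib.const_mul_left (a * m))
      (rfl : 1 + 0 = 1))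
    have e2 : (fun _ => (1 : ℝ)) =O[l] fun p => ε p ^ 0 := isBigO_const_pow_zero 1
    exact (((mono (by norm_num) n3).add e2).add e1).congr_left fun p => by ring
  -- expansion of the speed
  have s1 := sqrt_sq_add_sub_isBigO hδ hv hWv0 Wv2
  have vib : (fun p => (v p)⁻¹) =O[l] fun p => ε p ^ 0 := by
    rw [isBigO_pow_zero_iff]
    refine IsBigO.of_bound δ⁻¹ ?_
    filter_upwards [hv] with p hp
    rw [norm_one, mul_one, Real.norm_of_nonneg (inv_nonneg.2 (hδ.le.trans hp))]
    exact inv_anti₀ hδ hp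
  have k1 : (fun p => Wv p / (2 * v p) - (ε p * (h' p * wv p)
      - ε p ^ 2 * (v p * (h' p ^ 2 * d ^ 2 / 2)))) =O[l] fun p => ε p ^ 4 := by
    refine (isBigO_mul_pow hWv (vib.const_mul_left (1 / 2)) (rfl : 4 + 0 = 4)).congr' ?_
      EventuallyEq.rfl
    filter_upwards [hv] with p hp
    have h0 : v p ≠ 0 := (hδ.trans_le hp).ne'
    field_simp
  have k2 : (fun p => Wv p / (2 * v p) - ε p ^ 2 * (v p * (h' p ^ 2 * d ^ 2 / 2))) =O[l]
      fun p => ε p ^ 3 := by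
    have e1 := isBigO_mul_pow (isBigO_mul_pow E1 hb' (rfl : 1 + 0 = 1)) hwv (rfl : 1 + 2 = 3)
    exact ((mono (by norm_num) k1).add e1).congr_left fun p => by ring
  have k3 : (fun p => Wv p / (2 * v p)) =O[l] fun p => ε p ^ 2 := by
    have e1 := isBigO_mul_pow (E 2) (isBigO_mul_pow hvb (h'2b.const_mul_left (d ^ 2 / 2))
      (rfl : 0 + 0 = 0)) (rfl : 2 + 0 = 2)
    exact ((mono (by norm_num) k2).add e1).congr_left fun p => by ring
  -- the product
  have p1 := isBigO_mul_pow nb s1 (rfl : 0 + 4 = 4)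
  have p2 := isBigO_mul_pow n2 hvb (rfl : 4 + 0 = 4)
  have p3 := isBigO_mul_pow n3 k3 (rfl : 2 + 2 = 4)
  have p4 := isBigO_mul_pow (isBigO_mul_pow E1 (ib.const_mul_left (a * m)) (rfl : 1 + 0 = 1)) k2
    (rfl : 1 + 3 = 4)
  refine ((((p1.add p2).add p3).add p4).add k1).congr_left fun p => ?_
  ring

end Pointwise

/-! ### First estimates for a ray given by a convergent expansion -/

section SeriesBounds

variable {F : Type*} [NormedAddCommGroup F] [NormedSpace ℝ F]

theorem norm_tsum_pow_smul_le [CompleteSpace F] {y : ℕ → F} {C q t : ℝ} (hq : 0 < q)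
    (ht : 0 < t) (htq : t ≤ q / 2) (hy : ∀ n, 1 ≤ n → q ^ n * ‖y n‖ ≤ C) :
    (Summable fun n : ℕ => t ^ (n + 1) • y (n + 1)) ∧
      ‖∑' n : ℕ, t ^ (n + 1) • y (n + 1)‖ ≤ 2 * C / q * t := by
  have hb : ∀ n : ℕ, ‖t ^ (n + 1) • y (n + 1)‖ ≤ C / q * t * (1 / 2) ^ n := by
    intro n
    have h1 := hy (n + 1) (by omega)
    have hC : 0 ≤ C := le_trans (by positivity) h1
    have h2 : t / q ≤ 1 / 2 := by rw [div_le_iff₀ hq]; linarith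
    have h3 : (t / q) ^ n ≤ (1 / 2) ^ n := pow_le_pow_left₀ (by positivity) h2 n
    rw [norm_smul, norm_pow, Real.norm_of_nonneg ht.le]
    have h4 : ‖y (n + 1)‖ ≤ C / q ^ (n + 1) := by
      rw [le_div_iff₀ (by positivity)]; linarith
    calc t ^ (n + 1) * ‖y (n + 1)‖ ≤ t ^ (n + 1) * (C / q ^ (n + 1)) := by gcongr
      _ = C / q * t * (t / q) ^ n := by rw [div_pow]; field_simp; ring
      _ ≤ _ := by gcongr
  have hg : HasSum (fun n : ℕ => C / q * t * (1 / 2 : ℝ) ^ n) (2 * C / q * t) := by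
    have := (hasSum_geometric_two).mul_left (C / q * t)
    rwa [show C / q * t * 2 = 2 * C / q * t by ring] at this
  exact ⟨Summable.of_norm_bounded hg.summable hb, tsum_of_norm_bounded hg hb⟩

theorem norm_tsum_pow_smul_sub_le [CompleteSpace F] {X : ℕ → ℝ → F} {C q t : ℝ} (hq : 0 < q)
    (ht : 0 < t) (htq : t ≤ q / 2)
    (hX : ∀ n, 1 ≤ n → ∀ ξ ∈ Icc (0 : ℝ) 1, q ^ n * ‖X n ξ‖ ≤ C)
    (hX' : ∀ n, 1 ≤ n → ∀ ξ ∈ Icc (0 : ℝ) 1, q ^ n * ‖derivWithin (X n) (Icc 0 1) ξ‖ ≤ C)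
    (hd : ∀ n, 1 ≤ n → ContDiffOn ℝ 1 (X n) (Icc 0 1)) {ξ ζ : ℝ} (hξ : ξ ∈ Icc (0 : ℝ) 1)
    (hζ : ζ ∈ Icc (0 : ℝ) 1) :
    ‖(∑' n : ℕ, t ^ (n + 1) • X (n + 1) ζ) - ∑' n : ℕ, t ^ (n + 1) • X (n + 1) ξ‖
      ≤ 2 * C / q * t * |ζ - ξ| := by
  have s1 := (norm_tsum_pow_smul_le hq ht htq fun n hn => hX n hn ζ hζ).1
  have s2 := (norm_tsum_pow_smul_le hq ht htq fun n hn => hX n hn ξ hξ).1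
  rw [← s1.tsum_sub s2]
  have h := (norm_tsum_pow_smul_le (y := fun n => X n ζ - X n ξ) (C := C * |ζ - ξ|) hq ht htq
    fun n hn => ?_).2
  · simp only [← smul_sub]
    refine h.trans (le_of_eq ?_)
    ring
  · have h1 := (convex_Icc (0 : ℝ) 1).norm_image_sub_le_of_norm_derivWithin_le
      (f := X n) (C := C / q ^ n) ((hd n hn).differentiableOn one_ne_zero)
      (fun x hx => by
        rw [le_div_iff₀ (by positivity)]
        linarith [hX' n hn x hx]) hξ hζ
    calc q ^ n * ‖X n ζ - X n ξ‖ ≤ q ^ n * (C / q ^ n * ‖ζ - ξ‖) := by gcongr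
      _ = C * |ζ - ξ| := by rw [Real.norm_eq_abs]; field_simp

theorem norm_derivWithin_sub_le {f : ℝ → F} {v : F} {K ξ : ℝ}
    (hf : DifferentiableOn ℝ f (Icc 0 1)) (hξ : ξ ∈ Icc (0 : ℝ) 1)
    (h : ∀ ζ ∈ Icc (0 : ℝ) 1, ‖f ζ - f ξ - (ζ - ξ) • v‖ ≤ K * |ζ - ξ|) :
    ‖derivWithin f (Icc 0 1) ξ - v‖ ≤ K := by
  have h1 := hasDerivWithinAt_iff_tendsto_slope.1 (hf ξ hξ).hasDerivWithinAt
  have : NeBot (𝓝[Icc (0 : ℝ) 1 \ {ξ}] ξ) :=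
    accPt_principal_iff_nhdsWithin.1
      ((uniqueDiffOn_Icc (zero_lt_one' ℝ) ξ hξ).accPt)
  refine le_of_tendsto (h1.sub_const v).norm ?_
  filter_upwards [self_mem_nhdsWithin] with ζ hζ
  have h0 : ζ - ξ ≠ 0 := sub_ne_zero.2 hζ.2
  have h2 : slope f ξ ζ - v = (ζ - ξ)⁻¹ • (f ζ - f ξ - (ζ - ξ) • v) := by
    rw [smul_sub, smul_smul, inv_mul_cancel₀ h0, one_smul, slope_def_module]
  rw [h2, norm_smul, norm_inv, Real.norm_eq_abs, inv_mul_le_iff₀ (abs_pos.2 h0), mul_comm]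
  exact h ζ hζ.1

end SeriesBounds

/-- The filter of small positive values of the expansion parameter, uniformly in the affine
parameter. -/
def rayFilter : Filter (ℝ × ℝ) := 𝓝[>] (0 : ℝ) ×ˢ 𝓟 (Icc (0 : ℝ) 1)

theorem tendsto_fst_rayFilter : Tendsto (fun p : ℝ × ℝ => p.1) rayFilter (𝓝 0) :=
  (tendsto_fst.mono_right nhdsWithin_le_nhds)

theorem eventually_rayFilter {q : ℝ × ℝ → Prop} :
    (∀ᶠ p in rayFilter, q p) ↔ ∀ᶠ t in 𝓝[>] (0 : ℝ), ∀ ξ ∈ Icc (0 : ℝ) 1, q (t, ξ) :=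
  eventually_prod_principal_iff

theorem isBigO_rayFilter_iff {F : Type*} [NormedAddCommGroup F] {f : ℝ × ℝ → F} {k : ℕ} :
    (f =O[rayFilter] fun p => p.1 ^ k) ↔
      ∃ K, ∀ᶠ t in 𝓝[>] (0 : ℝ), ∀ ξ ∈ Icc (0 : ℝ) 1, ‖f (t, ξ)‖ ≤ K * t ^ k := by
  constructor
  · rintro h
    obtain ⟨K, hK⟩ := h.bound
    refine ⟨K, ?_⟩
    filter_upwards [eventually_rayFilter.1 hK, self_mem_nhdsWithin] with t ht ht0 ξ hξ
    have ht0 : 0 < t := ht0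
    simpa [abs_of_pos ht0] using ht ξ hξ
  · rintro ⟨K, hK⟩
    refine IsBigO.of_bound K (eventually_rayFilter.2 ?_)
    filter_upwards [hK, self_mem_nhdsWithin] with t ht ht0 ξ hξ
    have ht0 : 0 < t := ht0
    simpa [abs_of_pos ht0] using ht ξ hξ

/-- A quantity whose `ξ`-derivative is of order `k` varies by an amount of order `k`. -/
theorem isBigO_sub_of_hasDerivWithinAt {F : Type*} [NormedAddCommGroup F] [NormedSpace ℝ F]
    {f f' : ℝ × ℝ → F} {k : ℕ}
    (hf : ∀ᶠ t in 𝓝[>] (0 : ℝ), ∀ ξ ∈ Icc (0 : ℝ) 1,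
      HasDerivWithinAt (fun ζ => f (t, ζ)) (f' (t, ξ)) (Icc 0 1) ξ)
    (h : f' =O[rayFilter] fun p => p.1 ^ k) :
    (fun p : ℝ × ℝ => f p - f (p.1, 0)) =O[rayFilter] fun p => p.1 ^ k := by
  obtain ⟨K, hK⟩ := isBigO_rayFilter_iff.1 h
  refine isBigO_rayFilter_iff.2 ⟨K, ?_⟩
  filter_upwards [hf, hK, self_mem_nhdsWithin] with t h1 h2 h3 ξ hξ
  have h3 : 0 < t := h3
  have h0 : (0 : ℝ) ∈ Icc (0 : ℝ) 1 := by simp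
  have hK0 : 0 ≤ K * t ^ k := (norm_nonneg _).trans (h2 0 h0)
  have h4 := (convex_Icc (0 : ℝ) 1).norm_image_sub_le_of_norm_hasDerivWithin_le h1 h2 h0 hξ
  refine h4.trans (mul_le_of_le_one_right hK0 ?_)
  rw [sub_zero, Real.norm_of_nonneg hξ.1]
  exact hξ.2

theorem isBigO_eval_one {F : Type*} [NormedAddCommGroup F] {f : ℝ × ℝ → F} {k : ℕ}
    (h : f =O[rayFilter] fun p => p.1 ^ k) :
    (fun t : ℝ => f (t, 1)) =O[𝓝[>] 0] fun t => t ^ k := by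
  obtain ⟨K, hK⟩ := isBigO_rayFilter_iff.1 h
  refine IsBigO.of_bound K ?_
  filter_upwards [hK, self_mem_nhdsWithin] with t ht ht0
  have ht0 : 0 < t := ht0
  simpa [abs_of_pos ht0] using ht 1 (by simp)

theorem isBigO_comp_fst {F : Type*} [NormedAddCommGroup F] {f : ℝ → F} {k : ℕ}
    (h : f =O[𝓝[>] 0] fun t => t ^ k) :
    (fun p : ℝ × ℝ => f p.1) =O[rayFilter] fun p => p.1 ^ k :=
  h.comp_tendsto tendsto_fst

namespace IsQuasiMinkowskianRay

variable {P : PPNParameters} {m rh c tA : ℝ} {xA xB : E3} {X0 : ℕ → ℝ → ℝ} {X : ℕ → ℝ → E3}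

theorem eventually_isNullGeodesic (h : IsQuasiMinkowskianRay P m rh c tA xA xB X0 X) :
    ∀ᶠ t in 𝓝[>] (0 : ℝ),
      P.IsNullGeodesic (t * m) (rayTime c tA xA xB X0 t) (rayPos xA xB X t) := by
  obtain ⟨q, hq, -, hg⟩ := h.expansion
  filter_upwards [Ioo_mem_nhdsGT hq] with t ht
  exact (hg t ht.1 ht.2).2

theorem rayPos_zero (h : IsQuasiMinkowskianRay P m rh c tA xA xB X0 X) (t : ℝ) :
    rayPos xA xB X t 0 = xA := by
  simp [rayPos, segPoint, h.space_zero]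

theorem rayPos_one (h : IsQuasiMinkowskianRay P m rh c tA xA xB X0 X) (t : ℝ) :
    rayPos xA xB X t 1 = xB := by
  simp [rayPos, segPoint, h.space_one]

theorem rayTime_zero (h : IsQuasiMinkowskianRay P m rh c tA xA xB X0 X) (t : ℝ) :
    rayTime c tA xA xB X0 t 0 = c * tA := by
  simp [rayTime, h.time_zero]

theorem rayPos_isBigO (h : IsQuasiMinkowskianRay P m rh c tA xA xB X0 X) :
    (fun p : ℝ × ℝ => rayPos xA xB X p.1 p.2 - segPoint xA xB p.2) =O[rayFilter]
      fun p => p.1 ^ 1 := by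
  obtain ⟨q, hq, ⟨C, hC⟩, -⟩ := h.expansion
  refine isBigO_rayFilter_iff.2 ⟨2 * C / q, ?_⟩
  filter_upwards [Ioo_mem_nhdsGT (half_pos hq)] with t ht ξ hξ
  have := (norm_tsum_pow_smul_le (y := fun n => X n ξ) hq ht.1 ht.2.le
    fun n hn => (hC n hn ξ hξ).2.2.1).2
  simpa [rayPos] using this

theorem derivWithin_rayPos_isBigO (h : IsQuasiMinkowskianRay P m rh c tA xA xB X0 X) :
    (fun p : ℝ × ℝ => derivWithin (rayPos xA xB X p.1) (Icc 0 1) p.2 - (xB - xA)) =O[rayFilter]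
      fun p => p.1 ^ 1 := by
  obtain ⟨q, hq, ⟨C, hC⟩, -⟩ := h.expansion
  refine isBigO_rayFilter_iff.2 ⟨2 * C / q, ?_⟩
  filter_upwards [Ioo_mem_nhdsGT (half_pos hq), h.eventually_isNullGeodesic] with t ht hg ξ hξ
  refine norm_derivWithin_sub_le (hg.contDiffOn_space.differentiableOn two_ne_zero) hξ
    fun ζ hζ => ?_
  have := norm_tsum_pow_smul_sub_le (X := X) hq ht.1 ht.2.le
    (fun n hn x hx => (hC n hn x hx).2.2.1) (fun n hn x hx => (hC n hn x hx).2.2.2)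
    h.contDiffOn_space hξ hζ
  refine le_trans (le_of_eq (congrArg _ ?_)) (by simpa using this)
  simp only [rayPos, segPoint]
  module

theorem derivWithin_rayTime_isBigO (h : IsQuasiMinkowskianRay P m rh c tA xA xB X0 X) :
    (fun p : ℝ × ℝ => derivWithin (rayTime c tA xA xB X0 p.1) (Icc 0 1) p.2 - ‖xB - xA‖)
      =O[rayFilter] fun p => p.1 ^ 1 := by
  obtain ⟨q, hq, ⟨C, hC⟩, -⟩ := h.expansion
  refine isBigO_rayFilter_iff.2 ⟨2 * C / q, ?_⟩
  filter_upwards [Ioo_mem_nhdsGT (half_pos hq), h.eventually_isNullGeodesic] with t ht hg ξ hξ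
  refine norm_derivWithin_sub_le (hg.contDiffOn_time.differentiableOn two_ne_zero) hξ
    fun ζ hζ => ?_
  have := norm_tsum_pow_smul_sub_le (X := X0) hq ht.1 ht.2.le
    (fun n hn x hx => (hC n hn x hx).1) (fun n hn x hx => (hC n hn x hx).2.1)
    h.contDiffOn_time hξ hζ
  simp only [smul_eq_mul] at this
  refine le_trans (le_of_eq (congrArg _ ?_)) (by simpa using this)
  simp only [rayTime, smul_eq_mul]
  ring

/-- The coefficients of the expansion of the travel time can be read off from any third order
expansion of it. -/
theorem rayTime_one_isBigO (h : IsQuasiMinkowskianRay P m rh c tA xA xB X0 X) :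
    (fun t : ℝ => rayTime c tA xA xB X0 t 1 - (c * tA + ‖xB - xA‖ + X0 1 1 * t
      + X0 2 1 * t ^ 2 + X0 3 1 * t ^ 3)) =O[𝓝[>] 0] fun t => t ^ 4 := by
  obtain ⟨q, hq, ⟨C, hC⟩, -⟩ := h.expansion
  set a : ℕ → ℝ := fun n => if n = 0 then 0 else X0 n 1 with ha
  have hb : ∀ n, |a n| * q ^ n ≤ C := by
    intro n
    rcases Nat.eq_zero_or_pos n with rfl | hn
    · have := (hC 1 le_rfl 1 (by simp)).1
      simp only [ha, if_true, abs_zero, zero_mul]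
      exact le_trans (by positivity) this
    · have := (hC n hn 1 (by simp)).1
      simp only [ha, if_neg hn.ne']
      linarith
  have h1 := (powSum_sub_cubic_isBigO hq hb).mono nhdsWithin_le_nhds (l := 𝓝[>] (0 : ℝ))
  refine h1.congr' ?_ EventuallyEq.rfl
  filter_upwards [Ioo_mem_nhdsGT (half_pos hq)] with t ht
  have hs : Summable fun n : ℕ => t ^ (n + 1) • X0 (n + 1) 1 :=
    (norm_tsum_pow_smul_le (y := fun n => X0 n 1) hq ht.1 ht.2.le
      fun n hn => (hC n hn 1 (by simp)).1).1
  have hs' : Summable fun n : ℕ => a n * t ^ n := by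
    refine (summable_nat_add_iff 1).1 (hs.congr fun n => ?_)
    simp only [ha, smul_eq_mul, Nat.add_eq_zero_iff, one_ne_zero, and_false, if_false]
    ring
  have e : powSum a t = ∑' n : ℕ, t ^ (n + 1) * X0 (n + 1) 1 := by
    rw [powSum, hs'.tsum_eq_zero_add]
    simp [ha, mul_comm]
  rw [e]
  simp [rayTime, ha]
  ring

end IsQuasiMinkowskianRay

/-! ### The first order deflection -/

/-- The distance from the centre of the point of abscissa `s` on a line at distance `d`. -/
def lineDist (d s : ℝ) : ℝ := √(s ^ 2 + d ^ 2)

/-- The first order transverse displacement of the ray, in units of the foot `D` of the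
perpendicular from the centre. It is the solution of `h'' = - g / (s ^ 2 + d ^ 2) ^ (3 / 2)` that
vanishes at both ends of the ray when `α`, `k` are such that `α + k s` is the distance from the
centre there. -/
def bend (g d α k s : ℝ) : ℝ := -(g / d ^ 2) * (lineDist d s - α - k * s)

/-- The derivative of `bend`. -/
def bendDeriv (g d k s : ℝ) : ℝ := -(g / d ^ 2) * (s * (lineDist d s)⁻¹ - k)

theorem lineDist_pos {d : ℝ} (hd : 0 < d) (s : ℝ) : 0 < lineDist d s :=
  Real.sqrt_pos.2 (by positivity)

theorem lineDist_sq (d s : ℝ) : lineDist d s ^ 2 = s ^ 2 + d ^ 2 :=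
  Real.sq_sqrt (by positivity)

theorem le_lineDist (d s : ℝ) : d ≤ lineDist d s :=
  Real.le_sqrt_of_sq_le (by nlinarith [sq_nonneg s])

theorem abs_le_lineDist (d s : ℝ) : |s| ≤ lineDist d s :=
  Real.abs_le_sqrt (by nlinarith [sq_nonneg d])

theorem hasDerivAt_lineDist {d : ℝ} (hd : 0 < d) (s : ℝ) :
    HasDerivAt (lineDist d) (s * (lineDist d s)⁻¹) s := by
  have h : HasDerivAt (fun x : ℝ => x ^ 2 + d ^ 2) (2 * s) s := by
    simpa using (hasDerivAt_pow 2 s).add_const (d ^ 2)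
  refine (h.sqrt (by positivity)).congr_deriv ?_
  have := (lineDist_pos hd s).ne'
  simp only [lineDist] at this ⊢
  field_simp

theorem hasDerivAt_bend {g d α k : ℝ} (hd : 0 < d) (s : ℝ) :
    HasDerivAt (bend g d α k) (bendDeriv g d k s) s := by
  have h := ((((hasDerivAt_lineDist hd s).sub_const α).sub
    ((hasDerivAt_id s).const_mul k))).const_mul (-(g / d ^ 2))
  refine h.congr_deriv ?_
  simp [bendDeriv]

theorem hasDerivAt_bendDeriv {g d k : ℝ} (hd : 0 < d) (s : ℝ) :
    HasDerivAt (bendDeriv g d k) (-g * (lineDist d s)⁻¹ ^ 3) s := by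
  have h0 := (lineDist_pos hd s).ne'
  have h := ((((hasDerivAt_id s).mul ((hasDerivAt_lineDist hd s).inv h0)).sub_const k)).const_mul
    (-(g / d ^ 2))
  refine h.congr_deriv ?_
  have h2 := lineDist_sq d s
  simp only [id, Pi.inv_apply]
  field_simp
  linear_combination -g * h2

theorem abs_bendDeriv_le {g d k : ℝ} (hd : 0 < d) (s : ℝ) :
    |bendDeriv g d k s| ≤ |g / d ^ 2| * (1 + |k|) := by
  rw [bendDeriv, abs_mul, abs_neg]
  refine mul_le_mul_of_nonneg_left ((abs_sub _ _).trans ?_) (abs_nonneg _)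
  have h : |s * (lineDist d s)⁻¹| ≤ 1 := by
    rw [abs_mul, abs_inv, abs_of_pos (lineDist_pos hd s), ← div_eq_mul_inv,
      div_le_one (lineDist_pos hd s)]
    exact abs_le_lineDist d s
  linarith

theorem abs_bend_sub_le {g d α k : ℝ} (hd : 0 < d) (s t : ℝ) :
    |bend g d α k s - bend g d α k t| ≤ |g / d ^ 2| * (1 + |k|) * |s - t| :=
  convex_univ.norm_image_sub_le_of_norm_hasDerivWithin_le (𝕜 := ℝ)
    (fun x _ => (hasDerivAt_bend hd x).hasDerivWithinAt)
    (fun x _ => abs_bendDeriv_le hd x) (mem_univ t) (mem_univ s)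

theorem abs_bendDeriv_sub_le {g d k : ℝ} (hd : 0 < d) (s t : ℝ) :
    |bendDeriv g d k s - bendDeriv g d k t| ≤ |g| * d⁻¹ ^ 3 * |s - t| := by
  refine convex_univ.norm_image_sub_le_of_norm_hasDerivWithin_le (𝕜 := ℝ)
    (fun x _ => (hasDerivAt_bendDeriv hd x).hasDerivWithinAt)
    (fun x _ => ?_) (mem_univ t) (mem_univ s)
  rw [norm_mul, norm_neg, norm_pow, norm_inv, Real.norm_of_nonneg (lineDist_pos hd x).le,
    Real.norm_eq_abs]
  have := inv_anti₀ hd (le_lineDist d x)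
  have h0 := (inv_pos.2 (lineDist_pos hd x)).le
  gcongr

theorem inv_lineDist_isBigO_one {α : Type*} {l : Filter α} {ε : α → ℝ} {d : ℝ} (hd : 0 < d)
    (s : α → ℝ) : (fun p => (lineDist d (s p))⁻¹) =O[l] fun p => ε p ^ 0 := by
  rw [isBigO_pow_zero_iff]
  refine IsBigO.of_bound d⁻¹ (Eventually.of_forall fun p => ?_)
  rw [norm_one, mul_one, Real.norm_of_nonneg (inv_nonneg.2 (lineDist_pos hd _).le)]
  exact inv_anti₀ hd (le_lineDist d _)

/-! ### Transverse motion -/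

/-- Orthogonal projection onto the plane orthogonal to the unit vector `e`. -/
def transProj (e : E3) : E3 →L[ℝ] E3 :=
  ContinuousLinearMap.id ℝ E3 - (innerSL ℝ e).smulRight e

theorem transProj_apply (e x : E3) : transProj e x = x - (inner ℝ e x : ℝ) • e := by
  simp [transProj]

theorem transProj_smul_self {e : E3} (he : ‖e‖ = 1) (r : ℝ) : transProj e (r • e) = 0 := by
  simp [transProj_apply, he]

theorem transProj_smul_add {e D : E3} (he : ‖e‖ = 1) (heD : inner ℝ e D = 0) (r : ℝ) :
    transProj e (r • e + D) = D := by
  rw [map_add, transProj_smul_self he, zero_add, transProj_apply, heD, zero_smul, sub_zero]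

theorem inner_transProj {e : E3} (he : ‖e‖ = 1) (x : E3) : inner ℝ e (transProj e x) = 0 := by
  simp [transProj_apply, inner_sub_right, inner_smul_right, he]

theorem norm_sq_eq_add_transProj {e : E3} (he : ‖e‖ = 1) (x : E3) :
    ‖x‖ ^ 2 = (inner ℝ e x) ^ 2 + ‖transProj e x‖ ^ 2 := by
  rw [transProj_apply, @norm_sub_sq_real, inner_smul_right, norm_smul, he, real_inner_comm]
  simp
  ring

namespace PPNParameters

theorem gradient_metricForm (P : PPNParameters) {m v0 : ℝ} {v y : E3} (hy : y ≠ 0)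
    (hA : DifferentiableAt ℝ (powSum P.coeffA) (m / ‖y‖))
    (hB : DifferentiableAt ℝ (powSum P.coeffBinv) (m / ‖y‖)) :
    gradient (fun y : E3 => P.metricForm m y v0 v) y
      = (-(m * ‖y‖⁻¹ ^ 3) * (deriv (powSum P.coeffA) (m / ‖y‖) * v0 ^ 2
        - deriv (powSum P.coeffBinv) (m / ‖y‖) * ‖v‖ ^ 2)) • y := by
  have hn : 0 < ‖y‖ := norm_pos_iff.2 hy
  have hs : √(‖y‖ ^ 2) = ‖y‖ := Real.sqrt_sq hn.le
  -- the form depends on `y` through `‖y‖ ^ 2`, which is smooth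
  have h1 : HasDerivAt (fun x : ℝ => m / √x) (-(m * ‖y‖⁻¹ ^ 3) / 2) (‖y‖ ^ 2) := by
    have h2 := ((hasDerivAt_id (‖y‖ ^ 2)).sqrt (by simp only [id]; positivity)).inv
      (by simp only [id, hs]; exact hn.ne')
    have h3 := h2.const_mul m
    refine (h3.congr_deriv ?_)
    simp only [id, hs]
    field_simp
  have hA' : HasDerivAt (powSum P.coeffA) (deriv (powSum P.coeffA) (m / ‖y‖))
      ((fun x : ℝ => m / √x) (‖y‖ ^ 2)) := by
    simp only [hs]; exact hA.hasDerivAt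
  have hB' : HasDerivAt (powSum P.coeffBinv) (deriv (powSum P.coeffBinv) (m / ‖y‖))
      ((fun x : ℝ => m / √x) (‖y‖ ^ 2)) := by
    simp only [hs]; exact hB.hasDerivAt
  have h2 := ((HasDerivAt.comp (h := fun x : ℝ => m / √x) _ hA' h1).mul_const (v0 ^ 2)).sub 
    ((HasDerivAt.comp (h := fun x : ℝ => m / √x) _ hB' h1).mul_const (‖v‖ ^ 2))
  have h3 : HasFDerivAt (fun y : E3 => ‖y‖ ^ 2) (2 • innerSL ℝ y) y := by
    simpa using (hasFDerivAt_id y).norm_sq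
  have h4 := h2.comp_hasFDerivAt y h3
  refine HasGradientAt.gradient ?_
  rw [hasGradientAt_iff_hasFDerivAt]
  have e : (fun y : E3 => P.metricForm m y v0 v) =
      (((fun x => (powSum P.coeffA ∘ fun x : ℝ => m / √x) x * v0 ^ 2) - fun x =>
        (powSum P.coeffBinv ∘ fun x : ℝ => m / √x) x * ‖v‖ ^ 2) ∘ fun y : E3 => ‖y‖ ^ 2) := by
    funext z
    simp [metricForm, potA_eq_powSum, potBinv_eq_powSum, Real.sqrt_sq (norm_nonneg z)]
  rw [e]
  refine h4.congr_fderiv ?_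
  ext w
  simp
  ring

end PPNParameters

/-- The straight segment joining the ends of the ray does not pass through the centre: `e` is its
unit direction, `D` the foot of the perpendicular from the centre, and `[sA, sA + R]` the range of
the abscissa along it. -/
structure IsOffCentreSegment (xA xB e D : E3) (sA R d : ℝ) : Prop where
  norm_dir : ‖e‖ = 1
  inner_foot : inner ℝ e D = 0
  norm_foot : ‖D‖ = d
  dist_pos : 0 < d
  length_pos : 0 < R
  left_eq : xA = sA • e + D
  right_eq : xB = (sA + R) • e + D

namespace IsOffCentreSegment

variable {xA xB e D : E3} {sA R d : ℝ}

theorem sub_eq (S : IsOffCentreSegment xA xB e D sA R d) : xB - xA = R • e := by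
  rw [S.left_eq, S.right_eq]; module

theorem norm_sub (S : IsOffCentreSegment xA xB e D sA R d) : ‖xB - xA‖ = R := by
  rw [S.sub_eq, norm_smul, S.norm_dir, mul_one, Real.norm_of_nonneg S.length_pos.le]

theorem segPoint_eq (S : IsOffCentreSegment xA xB e D sA R d) (ξ : ℝ) :
    segPoint xA xB ξ = (sA + ξ * R) • e + D := by
  rw [segPoint, S.sub_eq, S.left_eq]; module

theorem transProj_left (S : IsOffCentreSegment xA xB e D sA R d) : transProj e xA = D := by
  rw [S.left_eq, transProj_smul_add S.norm_dir S.inner_foot]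

theorem transProj_right (S : IsOffCentreSegment xA xB e D sA R d) : transProj e xB = D := by
  rw [S.right_eq, transProj_smul_add S.norm_dir S.inner_foot]

theorem inner_smul_add (S : IsOffCentreSegment xA xB e D sA R d) (r : ℝ) :
    inner ℝ e (r • e + D) = r := by
  simp [inner_add_right, inner_smul_right, S.norm_dir, S.inner_foot]

theorem inner_left (S : IsOffCentreSegment xA xB e D sA R d) : inner ℝ e xA = sA := by
  rw [S.left_eq, S.inner_smul_add]

theorem inner_right (S : IsOffCentreSegment xA xB e D sA R d) : inner ℝ e xB = sA + R := by
  rw [S.right_eq, S.inner_smul_add]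

theorem norm_smul_add (S : IsOffCentreSegment xA xB e D sA R d) (r : ℝ) :
    ‖r • e + D‖ = lineDist d r := by
  rw [lineDist, ← Real.sqrt_sq (norm_nonneg (r • e + D)), norm_sq_eq_add_transProj S.norm_dir,
    S.inner_smul_add, transProj_smul_add S.norm_dir S.inner_foot, S.norm_foot]

theorem norm_segPoint (S : IsOffCentreSegment xA xB e D sA R d) (ξ : ℝ) :
    ‖segPoint xA xB ξ‖ = lineDist d (sA + ξ * R) := by
  rw [S.segPoint_eq, S.norm_smul_add]

end IsOffCentreSegment

namespace IsQuasiMinkowskianRay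

variable {P : PPNParameters} {m rh c tA : ℝ} {xA xB : E3} {X0 : ℕ → ℝ → ℝ} {X : ℕ → ℝ → E3}
  {e D : E3} {sA R d : ℝ}

theorem norm_rayPos_sub_isBigO (h : IsQuasiMinkowskianRay P m rh c tA xA xB X0 X)
    (S : IsOffCentreSegment xA xB e D sA R d) :
    (fun p : ℝ × ℝ => ‖rayPos xA xB X p.1 p.2‖ - lineDist d (sA + p.2 * R)) =O[rayFilter]
      fun p => p.1 ^ 1 := by
  refine IsBigO.trans (isBigO_of_le _ fun p => ?_) h.rayPos_isBigO
  rw [← S.norm_segPoint]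
  exact abs_norm_sub_norm_le _ _

theorem eventually_le_norm_rayPos (h : IsQuasiMinkowskianRay P m rh c tA xA xB X0 X)
    (S : IsOffCentreSegment xA xB e D sA R d) :
    ∀ᶠ p in rayFilter, d / 2 ≤ ‖rayPos xA xB X p.1 p.2‖ := by
  have h1 := tendsto_zero_of_isBigO tendsto_fst_rayFilter (h.norm_rayPos_sub_isBigO S)
  filter_upwards [h1.eventually_const_lt (show -(d / 2) < 0 by linarith [S.dist_pos])] with p hp
  linarith [le_lineDist d (sA + p.2 * R)]

theorem inv_norm_rayPos_isBigO_one (h : IsQuasiMinkowskianRay P m rh c tA xA xB X0 X)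
    (S : IsOffCentreSegment xA xB e D sA R d) :
    (fun p : ℝ × ℝ => ‖rayPos xA xB X p.1 p.2‖⁻¹) =O[rayFilter] fun p => p.1 ^ 0 := by
  rw [isBigO_pow_zero_iff]
  refine IsBigO.of_bound (d / 2)⁻¹ ?_
  filter_upwards [h.eventually_le_norm_rayPos S] with p hp
  rw [norm_one, mul_one, Real.norm_of_nonneg (inv_nonneg.2 (norm_nonneg _))]
  exact inv_anti₀ (half_pos S.dist_pos) hp

theorem inv_norm_rayPos_sub_isBigO (h : IsQuasiMinkowskianRay P m rh c tA xA xB X0 X)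
    (S : IsOffCentreSegment xA xB e D sA R d) :
    (fun p : ℝ × ℝ => ‖rayPos xA xB X p.1 p.2‖⁻¹ - (lineDist d (sA + p.2 * R))⁻¹) =O[rayFilter]
      fun p => p.1 ^ 1 := by
  have h1 := isBigO_mul_pow (isBigO_mul_pow (h.norm_rayPos_sub_isBigO S)
    (h.inv_norm_rayPos_isBigO_one S) (rfl : 1 + 0 = 1))
    ((inv_lineDist_isBigO_one S.dist_pos fun p : ℝ × ℝ => sA + p.2 * R).const_mul_left (-1))
    (rfl : 1 + 0 = 1)
  refine h1.congr' ?_ EventuallyEq.rfl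
  filter_upwards [h.eventually_le_norm_rayPos S] with p hp
  have h2 : ‖rayPos xA xB X p.1 p.2‖ ≠ 0 := ((half_pos S.dist_pos).trans_le hp).ne'
  have h3 := (lineDist_pos S.dist_pos (sA + p.2 * R)).ne'
  field_simp
  ring

theorem massRatio_isBigO (h : IsQuasiMinkowskianRay P m rh c tA xA xB X0 X)
    (S : IsOffCentreSegment xA xB e D sA R d) :
    (fun p : ℝ × ℝ => p.1 * m / ‖rayPos xA xB X p.1 p.2‖) =O[rayFilter] fun p => p.1 ^ 1 := by
  have e1 : (fun p : ℝ × ℝ => p.1) =O[rayFilter] fun p => p.1 ^ 1 := by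
    simpa using isBigO_refl (fun p : ℝ × ℝ => p.1) rayFilter
  exact (isBigO_mul_pow e1 ((h.inv_norm_rayPos_isBigO_one S).const_mul_left m)
    (rfl : 1 + 0 = 1)).congr_left fun p => by ring

/-- The magnitude of the force in the spatial geodesic equation, at leading order. -/
theorem force_isBigO (h : IsQuasiMinkowskianRay P m rh c tA xA xB X0 X)
    (S : IsOffCentreSegment xA xB e D sA R d) {K q : ℝ} (hq : 0 < q)
    (hA : ∀ n, |P.coeffA n| * q ^ n ≤ K) (hB : ∀ n, |P.coeffBinv n| * q ^ n ≤ K) :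
    (fun p : ℝ × ℝ => -(m * ‖rayPos xA xB X p.1 p.2‖⁻¹ ^ 3) *
        (deriv (powSum P.coeffA) (p.1 * m / ‖rayPos xA xB X p.1 p.2‖)
            * derivWithin (rayTime c tA xA xB X0 p.1) (Icc 0 1) p.2 ^ 2
          - deriv (powSum P.coeffBinv) (p.1 * m / ‖rayPos xA xB X p.1 p.2‖)
            * ‖derivWithin (rayPos xA xB X p.1) (Icc 0 1) p.2‖ ^ 2)
      - 2 * ((1 + P.gamma) * m) * R ^ 2 * (lineDist d (sA + p.2 * R))⁻¹ ^ 3) =O[rayFilter]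
      fun p => p.1 ^ 1 := by
  have hε := tendsto_fst_rayFilter
  have u1 := h.massRatio_isBigO S
  have ut := tendsto_zero_of_isBigO hε u1
  have u1' : (fun p : ℝ × ℝ => (p.1 * m / ‖rayPos xA xB X p.1 p.2‖) ^ 1) =O[rayFilter]
      fun p => p.1 ^ 1 := by simpa using u1
  have dA := ((deriv_powSum_sub_isBigO hq hA).comp_tendsto ut).trans u1'
  have dB := ((deriv_powSum_sub_isBigO hq hB).comp_tendsto ut).trans u1'
  simp only [Function.comp_def, PPNParameters.coeffA, PPNParameters.coeffBinv] at dA dB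
  have t1 := h.derivWithin_rayTime_isBigO
  have x1 : (fun p : ℝ × ℝ => ‖derivWithin (rayPos xA xB X p.1) (Icc 0 1) p.2‖ - R) =O[rayFilter]
      fun p => p.1 ^ 1 := by
    refine IsBigO.trans (isBigO_of_le _ fun p => ?_) h.derivWithin_rayPos_isBigO
    rw [← S.norm_sub]
    exact abs_norm_sub_norm_le _ _
  rw [S.norm_sub] at t1
  have i1 := h.inv_norm_rayPos_sub_isBigO S
  have ib := inv_lineDist_isBigO_one (l := rayFilter) (ε := fun p => p.1) S.dist_pos
    fun p : ℝ × ℝ => sA + p.2 * R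
  have rb := h.inv_norm_rayPos_isBigO_one S
  set T : ℝ × ℝ → ℝ := fun p => derivWithin (rayTime c tA xA xB X0 p.1) (Icc 0 1) p.2
  set V : ℝ × ℝ → ℝ := fun p => ‖derivWithin (rayPos xA xB X p.1) (Icc 0 1) p.2‖
  set r : ℝ × ℝ → ℝ := fun p => ‖rayPos xA xB X p.1 p.2‖⁻¹
  set i : ℝ × ℝ → ℝ := fun p => (lineDist d (sA + p.2 * R))⁻¹
  have cb : ∀ a : ℝ, (fun _ => a) =O[rayFilter] fun p : ℝ × ℝ => p.1 ^ 0 :=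
    fun a => isBigO_const_pow_zero a
  have sqr : ∀ {f : ℝ × ℝ → ℝ}, ((fun p => f p - R) =O[rayFilter] fun p : ℝ × ℝ => p.1 ^ 1) →
      ((fun p => f p ^ 2 - R ^ 2) =O[rayFilter] fun p : ℝ × ℝ => p.1 ^ 1) ∧
      ((fun p => f p ^ 2) =O[rayFilter] fun p : ℝ × ℝ => p.1 ^ 0) := by
    intro f hf
    have h1 : (fun p => f p + R) =O[rayFilter] fun p : ℝ × ℝ => p.1 ^ 0 :=
      ((isBigO_pow_of_le hε (Nat.zero_le 1) hf).add (cb (2 * R))).congr_left fun p => by ring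
    have h2 : (fun p => f p ^ 2 - R ^ 2) =O[rayFilter] fun p : ℝ × ℝ => p.1 ^ 1 :=
      (isBigO_mul_pow hf h1 (rfl : 1 + 0 = 1)).congr_left fun p => by ring
    exact ⟨h2, ((isBigO_pow_of_le hε (Nat.zero_le 1) h2).add (cb (R ^ 2))).congr_left
      fun p => by ring⟩
  obtain ⟨T1, Tb⟩ := sqr t1
  obtain ⟨V1, Vb⟩ := sqr x1
  have r3 : (fun p => r p ^ 3) =O[rayFilter] fun p : ℝ × ℝ => p.1 ^ 0 :=
    (isBigO_mul_pow (isBigO_mul_pow rb rb (rfl : 0 + 0 = 0)) rb (rfl : 0 + 0 = 0)).congr_left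
      fun p => by ring
  have ri : (fun p => r p ^ 3 - i p ^ 3) =O[rayFilter] fun p : ℝ × ℝ => p.1 ^ 1 := by
    have h1 := ((isBigO_mul_pow rb rb (rfl : 0 + 0 = 0)).add
      (isBigO_mul_pow rb ib (rfl : 0 + 0 = 0))).add (isBigO_mul_pow ib ib (rfl : 0 + 0 = 0))
    exact (isBigO_mul_pow i1 h1 (rfl : 1 + 0 = 1)).congr_left fun p => by ring
  have q1 := isBigO_mul_pow dA Tb (rfl : 1 + 0 = 1)
  have q2 := isBigO_mul_pow dB Vb (rfl : 1 + 0 = 1)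
  have q3 := ((q1.add (T1.const_mul_left (-2))).sub q2).sub (V1.const_mul_left (2 * P.gamma))
  have q4 := isBigO_mul_pow (r3.const_mul_left (-m)) q3 (rfl : 0 + 1 = 1)
  have q5 := q4.add (ri.const_mul_left (2 * ((1 + P.gamma) * m) * R ^ 2))
  refine q5.congr_left fun p => ?_
  ring

/-- The transverse part of the ray is known to first order. The transverse momentum is obtained by
integrating the spatial geodesic equation along the unperturbed segment; the constant of
integration is fixed by the condition that the displacement vanishes at both ends. -/
theorem transverse_isBigO (h : IsQuasiMinkowskianRay P m rh c tA xA xB X0 X)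
    (S : IsOffCentreSegment xA xB e D sA R d) {K q : ℝ} (hq : 0 < q)
    (hA : ∀ n, |P.coeffA n| * q ^ n ≤ K) (hB : ∀ n, |P.coeffBinv n| * q ^ n ≤ K) {α k : ℝ}
    (hα : α + k * sA = lineDist d sA) (hα' : α + k * (sA + R) = lineDist d (sA + R)) :
    ((fun p : ℝ × ℝ => transProj e (rayPos xA xB X p.1 p.2) - D
      - (p.1 * bend ((1 + P.gamma) * m) d α k (sA + p.2 * R)) • D) =O[rayFilter]
      fun p => p.1 ^ 2) ∧
    ((fun p : ℝ × ℝ => transProj e (derivWithin (rayPos xA xB X p.1) (Icc 0 1) p.2)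
      - (p.1 * (bendDeriv ((1 + P.gamma) * m) d k (sA + p.2 * R) * R)) • D) =O[rayFilter]
      fun p => p.1 ^ 2) := by
  have hε := tendsto_fst_rayFilter
  have e1 : (fun p : ℝ × ℝ => p.1) =O[rayFilter] fun p => p.1 ^ 1 := by
    simpa using isBigO_refl (fun p : ℝ × ℝ => p.1) rayFilter
  set g : ℝ := (1 + P.gamma) * m with hg
  have hforce := h.force_isBigO S hq hA hB
  have u1 := h.massRatio_isBigO S
  have ut := tendsto_zero_of_isBigO hε u1
  -- derivatives of the reference functions
  have hs : ∀ ξ : ℝ, HasDerivWithinAt (fun ζ : ℝ => sA + ζ * R) R (Icc 0 1) ξ := fun ξ => by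
    simpa using (((hasDerivAt_id ξ).mul_const R).const_add sA).hasDerivWithinAt (s := Icc 0 1)
  have hb : ∀ ξ : ℝ, HasDerivWithinAt (fun ζ : ℝ => bend g d α k (sA + ζ * R))
      (bendDeriv g d k (sA + ξ * R) * R) (Icc 0 1) ξ := fun ξ =>
    (hasDerivAt_bend S.dist_pos _).comp_hasDerivWithinAt ξ (hs ξ)
  have hb' : ∀ ξ : ℝ, HasDerivWithinAt (fun ζ : ℝ => bendDeriv g d k (sA + ζ * R))
      (-g * (lineDist d (sA + ξ * R))⁻¹ ^ 3 * R) (Icc 0 1) ξ := fun ξ =>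
    (hasDerivAt_bendDeriv S.dist_pos _).comp_hasDerivWithinAt ξ (hs ξ)
  set φ : ℝ × ℝ → ℝ := fun p => -(m * ‖rayPos xA xB X p.1 p.2‖⁻¹ ^ 3) *
        (deriv (powSum P.coeffA) (p.1 * m / ‖rayPos xA xB X p.1 p.2‖)
            * derivWithin (rayTime c tA xA xB X0 p.1) (Icc 0 1) p.2 ^ 2
          - deriv (powSum P.coeffBinv) (p.1 * m / ‖rayPos xA xB X p.1 p.2‖)
            * ‖derivWithin (rayPos xA xB X p.1) (Icc 0 1) p.2‖ ^ 2) with hφ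
  set ω : ℝ × ℝ → E3 := fun p => transProj e (rayPos xA xB X p.1 p.2) - D with hω
  set ω' : ℝ × ℝ → E3 :=
    fun p => transProj e (derivWithin (rayPos xA xB X p.1) (Icc 0 1) p.2) with hω'
  have ω1 : ω =O[rayFilter] fun p => p.1 ^ 1 := by
    refine ((transProj e).isBigO_comp _ _).trans h.rayPos_isBigO |>.congr_left fun p => ?_
    rw [map_sub, S.segPoint_eq, transProj_smul_add S.norm_dir S.inner_foot]
  have ω'1 : ω' =O[rayFilter] fun p => p.1 ^ 1 := by
    refine ((transProj e).isBigO_comp _ _).trans h.derivWithin_rayPos_isBigO |>.congr_left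
      fun p => ?_
    rw [map_sub, S.sub_eq, transProj_smul_self S.norm_dir, sub_zero]
  -- transverse momentum, corrected by its expected variation
  set μ : ℝ × ℝ → E3 := fun p => transProj e
    ((-2 * P.potBinv (p.1 * m) ‖rayPos xA xB X p.1 p.2‖) •
      derivWithin (rayPos xA xB X p.1) (Icc 0 1) p.2)
      + (p.1 * (2 * R * bendDeriv g d k (sA + p.2 * R))) • D with hμ
  set μ' : ℝ × ℝ → E3 := fun p => (p.1 * φ p) • ω p
      + (p.1 * (φ p - 2 * g * R ^ 2 * (lineDist d (sA + p.2 * R))⁻¹ ^ 3)) • D with hμ'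
  have hμd : ∀ᶠ t in 𝓝[>] (0 : ℝ), ∀ ξ ∈ Icc (0 : ℝ) 1,
      HasDerivWithinAt (fun ζ => μ (t, ζ)) (μ' (t, ξ)) (Icc 0 1) ξ := by
    filter_upwards [h.eventually_isNullGeodesic,
      eventually_rayFilter.1 (h.eventually_le_norm_rayPos S),
      eventually_rayFilter.1 (ut.eventually (differentiableAt_powSum hq hA)),
      eventually_rayFilter.1 (ut.eventually (differentiableAt_powSum hq hB))]
      with t hgeo hx hdA hdB ξ hξ
    have hx0 : rayPos xA xB X t ξ ≠ 0 :=
      norm_pos_iff.1 ((half_pos S.dist_pos).trans_le (hx ξ hξ))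
    have h1 := hgeo.space_eq ξ hξ
    rw [P.gradient_metricForm hx0 (hdA ξ hξ) (hdB ξ hξ)] at h1
    have h2 := (transProj e).hasFDerivAt.comp_hasDerivWithinAt ξ h1
    have h3 := (((hb' ξ).const_mul (2 * R)).const_mul t).smul_const D
    refine (h2.add h3).congr_deriv ?_
    have h4 : transProj e (rayPos xA xB X t ξ) = ω (t, ξ) + D := by simp only [hω]; abel
    simp only [hμ', hφ, map_smul, h4]
    module
  have φb : φ =O[rayFilter] fun p => p.1 ^ 0 := by
    have ib := inv_lineDist_isBigO_one (l := rayFilter) (ε := fun p => p.1) S.dist_pos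
      fun p : ℝ × ℝ => sA + p.2 * R
    have i3 := isBigO_mul_pow (isBigO_mul_pow ib ib (rfl : 0 + 0 = 0)) ib (rfl : 0 + 0 = 0)
    exact ((isBigO_pow_of_le hε (Nat.zero_le 1) hforce).add
      (i3.const_mul_left (2 * g * R ^ 2))).congr_left fun p => by ring
  have hμ2 : μ' =O[rayFilter] fun p => p.1 ^ 2 := by
    refine (isBigO_smul_pow (isBigO_mul_pow e1 φb (rfl : 1 + 0 = 1)) ω1 (rfl : 1 + 1 = 2)).add ?_
    exact isBigO_smul_pow (isBigO_mul_pow e1 hforce (rfl : 1 + 1 = 2))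
      (isBigO_const_pow_zero D) (rfl : 2 + 0 = 2)
  have hμv := isBigO_sub_of_hasDerivWithinAt hμd hμ2
  -- velocity up to a constant
  set cst : ℝ → E3 := fun t => (-(1 / 2 : ℝ)) • μ (t, 0) with hcst
  have hvel : (fun p => ω' p - (p.1 * (bendDeriv g d k (sA + p.2 * R) * R)) • D - cst p.1)
      =O[rayFilter] fun p => p.1 ^ 2 := by
    have hBinv : (fun p : ℝ × ℝ => P.potBinv (p.1 * m) ‖rayPos xA xB X p.1 p.2‖ - 1)
        =O[rayFilter] fun p => p.1 ^ 1 := by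
      have hd := (hasFPowerSeriesAt_powSum hq hB).differentiableAt.isBigO_sub
      have h0 : powSum P.coeffBinv 0 = 1 := by
        rw [powSum, tsum_eq_single 0 (fun n hn => by simp [hn])]; simp [PPNParameters.coeffBinv]
      have hu : ((fun u : ℝ => u - 0) ∘ fun p : ℝ × ℝ => p.1 * m / ‖rayPos xA xB X p.1 p.2‖)
          =O[rayFilter] fun p => p.1 ^ 1 := u1.congr_left fun p => by simp
      have := (hd.comp_tendsto ut).trans hu
      simpa [Function.comp_def, h0, PPNParameters.potBinv_eq_powSum] using this
    have h1 := isBigO_smul_pow (hBinv.const_mul_left (-1)) ω'1 (rfl : 1 + 1 = 2)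
    refine ((hμv.const_smul_left (-(1 / 2 : ℝ))).add h1).congr_left fun p => ?_
    simp only [hcst, hμ, hω', Pi.smul_apply, map_smul]
    module
  -- displacement up to a linear function
  set f : ℝ × ℝ → E3 := fun p => ω p - (p.1 * bend g d α k (sA + p.2 * R)) • D - p.2 • cst p.1
    with hf
  have hfd : ∀ᶠ t in 𝓝[>] (0 : ℝ), ∀ ξ ∈ Icc (0 : ℝ) 1,
      HasDerivWithinAt (fun ζ => f (t, ζ)) (ω' (t, ξ)
        - (t * (bendDeriv g d k (sA + ξ * R) * R)) • D - cst t) (Icc 0 1) ξ := by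
    filter_upwards [h.eventually_isNullGeodesic] with t hgeo ξ hξ
    have h1 := (hgeo.contDiffOn_space.differentiableOn two_ne_zero ξ hξ).hasDerivWithinAt
    have h2 := ((transProj e).hasFDerivAt.comp_hasDerivWithinAt ξ h1).sub_const D
    have h3 := ((hb ξ).const_mul t).smul_const D
    have h4 := ((hasDerivAt_id ξ).hasDerivWithinAt (s := Icc (0 : ℝ) 1)).smul_const (cst t)
    refine ((h2.sub h3).sub h4).congr_deriv ?_
    simp [hω']
  have hfv := isBigO_sub_of_hasDerivWithinAt hfd hvel
  have hb0 : bend g d α k sA = 0 := by rw [bend, ← hα]; ring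
  have hb1 : bend g d α k (sA + R) = 0 := by rw [bend, ← hα']; ring
  have hf0 : ∀ t, f (t, 0) = 0 := by
    intro t
    simp only [hf, hω, h.rayPos_zero, S.transProj_left, zero_mul, add_zero, hb0]
    simp
  have hf1 : ∀ t, f (t, 1) = -cst t := by
    intro t
    simp only [hf, hω, h.rayPos_one, S.transProj_right, one_mul, hb1]
    simp
  simp only [hf0, sub_zero] at hfv
  have hc : (fun p : ℝ × ℝ => cst p.1) =O[rayFilter] fun p => p.1 ^ 2 := by
    have h1 := isBigO_eval_one hfv
    simp only [hf1] at h1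
    exact isBigO_comp_fst h1.neg_left |>.congr_left fun p => by simp
  have hξ : (fun p : ℝ × ℝ => p.2) =O[rayFilter] fun p => p.1 ^ 0 :=
    isBigO_rayFilter_iff.2 ⟨1, Eventually.of_forall fun t ξ hξ => by
      simpa [abs_of_nonneg hξ.1] using hξ.2⟩
  refine ⟨(hfv.add (isBigO_smul_pow hξ hc (rfl : 0 + 2 = 2))).congr_left fun p => ?_,
    (hvel.add hc).congr_left fun p => ?_⟩
  · simp only [hf, hω]; abel
  · abel

end IsQuasiMinkowskianRay

/-! ### The travel time in terms of antiderivatives -/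

namespace IsQuasiMinkowskianRay

variable {P : PPNParameters} {m rh c tA : ℝ} {xA xB : E3} {X0 : ℕ → ℝ → ℝ} {X : ℕ → ℝ → E3}
  {e D : E3} {sA R d : ℝ}

/-- The null condition: the time coordinate runs at the rate of the optical length. -/
theorem derivWithin_rayTime_eq (h : IsQuasiMinkowskianRay P m rh c tA xA xB X0 X)
    (S : IsOffCentreSegment xA xB e D sA R d) {K q : ℝ} (hq : 0 < q)
    (hA : ∀ n, |P.coeffA n| * q ^ n ≤ K) (hB : ∀ n, |P.coeffBinv n| * q ^ n ≤ K) :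
    ∀ᶠ p in rayFilter, P.refractiveIndex (p.1 * m / ‖rayPos xA xB X p.1 p.2‖)
      * ‖derivWithin (rayPos xA xB X p.1) (Icc 0 1) p.2‖
      = derivWithin (rayTime c tA xA xB X0 p.1) (Icc 0 1) p.2 := by
  have hε := tendsto_fst_rayFilter
  have ut := tendsto_zero_of_isBigO hε (h.massRatio_isBigO S)
  have lA := (PPNParameters.tendsto_powSum_coeffA hq hA).comp ut
  have lB := (PPNParameters.tendsto_powSum_coeffBinv hq hB).comp ut
  have t1 := tendsto_zero_of_isBigO hε h.derivWithin_rayTime_isBigO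
  rw [S.norm_sub] at t1
  have hgeo : ∀ᶠ p in rayFilter, P.metricForm (p.1 * m) (rayPos xA xB X p.1 p.2)
      (derivWithin (rayTime c tA xA xB X0 p.1) (Icc 0 1) p.2)
      (derivWithin (rayPos xA xB X p.1) (Icc 0 1) p.2) = 0 := by
    refine eventually_rayFilter.2 ?_
    filter_upwards [h.eventually_isNullGeodesic] with t ht ξ hξ
    exact ht.null ξ hξ
  filter_upwards [hgeo, lA.eventually_const_lt (zero_lt_one' ℝ),
    lB.eventually_const_lt (zero_lt_one' ℝ),
    t1.eventually_const_lt (neg_lt_zero.2 S.length_pos)] with p h1 h2 h3 h4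
  simp only [Function.comp] at h2 h3
  rw [PPNParameters.metricForm, PPNParameters.potA_eq_powSum, PPNParameters.potBinv_eq_powSum]
    at h1
  rw [PPNParameters.refractiveIndex]
  refine (pow_left_inj₀ (by positivity) (by linarith) two_ne_zero).1 ?_
  rw [mul_pow, Real.sq_sqrt (div_nonneg h3.le h2.le)]
  field_simp
  linarith

/-- Reduction of the perturbation terms of the time coordinate to quadratures along the unperturbed
segment: only the first order deflection is needed up to third order. -/
theorem time_terms_eq (h : IsQuasiMinkowskianRay P m rh c tA xA xB X0 X)
    (S : IsOffCentreSegment xA xB e D sA R d) {K q : ℝ} (hq : 0 < q)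
    (hA : ∀ n, |P.coeffA n| * q ^ n ≤ K) (hB : ∀ n, |P.coeffBinv n| * q ^ n ≤ K) {α k : ℝ}
    (hα : α + k * sA = lineDist d sA) (hα' : α + k * (sA + R) = lineDist d (sA + R))
    {a b b' : ℝ} (ha : a = 1 + P.gamma) (hb : b = P.kappa - a ^ 2 / 2)
    (hb' : b' = P.kappa3 - a * P.kappa + a ^ 3 / 2) {F₁ F₂ F₃ : ℝ → ℝ}
    (h₁ : ∀ s, HasDerivAt F₁ (a * m * (lineDist d s)⁻¹) s)
    (h₂ : ∀ s, HasDerivAt F₂ (b * m ^ 2 * (lineDist d s)⁻¹ ^ 2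
      - bendDeriv (a * m) d k s ^ 2 * d ^ 2 / 2) s)
    (h₃ : ∀ s, HasDerivAt F₃ (b' * m ^ 3 * (lineDist d s)⁻¹ ^ 3
      - 2 * b * m ^ 2 * bend (a * m) d α k s * d ^ 2 * (lineDist d s)⁻¹ ^ 4
      + a * m * bend (a * m) d α k s ^ 2 * d ^ 2 * (-(lineDist d s)⁻¹ ^ 3 / 2
        + 3 / 2 * d ^ 2 * (lineDist d s)⁻¹ ^ 5)
      + a * m * bendDeriv (a * m) d k s ^ 2 * d ^ 2 * (lineDist d s)⁻¹ / 2) s) :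
    X0 2 1 = F₂ (sA + R) - F₂ sA ∧ X0 3 1 = F₃ (sA + R) - F₃ sA := by
  have hε := tendsto_fst_rayFilter
  have e1 : (fun p : ℝ × ℝ => p.1) =O[rayFilter] fun p => p.1 ^ 1 := by
    simpa using isBigO_refl (fun p : ℝ × ℝ => p.1) rayFilter
  have hd := S.dist_pos
  obtain ⟨hdisp, hvel⟩ := h.transverse_isBigO S hq hA hB hα hα'
  rw [← ha] at hdisp hvel
  have hN := PPNParameters.refractiveIndex_sub_isBigO hq hA hB
  rw [← ha, ← hb, ← hb'] at hN
  have hx1 := h.rayPos_isBigO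
  have hv1 := h.derivWithin_rayPos_isBigO
  set x : ℝ × ℝ → E3 := fun p => rayPos xA xB X p.1 p.2 with hx
  set x' : ℝ × ℝ → E3 := fun p => derivWithin (rayPos xA xB X p.1) (Icc 0 1) p.2 with hx'
  set s : ℝ × ℝ → ℝ := fun p => inner ℝ e (x p) with hs
  set v : ℝ × ℝ → ℝ := fun p => inner ℝ e (x' p) with hv
  set ω : ℝ × ℝ → E3 := fun p => transProj e (x p) - D with hω
  set ω' : ℝ × ℝ → E3 := fun p => transProj e (x' p) with hω'
  set η : ℝ × ℝ → ℝ := fun p => bend (a * m) d α k (s p) with hη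
  set η' : ℝ × ℝ → ℝ := fun p => bendDeriv (a * m) d k (s p) with hη'
  -- longitudinal motion
  have s1 : (fun p => s p - (sA + p.2 * R)) =O[rayFilter] fun p => p.1 ^ 1 := by
    refine (isBigO_inner_pow (isBigO_const_pow_zero e) hx1 (rfl : 0 + 1 = 1)).congr_left
      fun p => ?_
    rw [inner_sub_right, S.segPoint_eq, S.inner_smul_add]
  have v1 : (fun p => v p - R) =O[rayFilter] fun p => p.1 ^ 1 := by
    refine (isBigO_inner_pow (isBigO_const_pow_zero e) hv1 (rfl : 0 + 1 = 1)).congr_left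
      fun p => ?_
    rw [inner_sub_right, S.sub_eq, inner_smul_right, real_inner_self_eq_norm_sq, S.norm_dir]
    ring
  have vb : v =O[rayFilter] fun p => p.1 ^ 0 :=
    ((isBigO_pow_of_le hε (Nat.zero_le 1) v1).add (isBigO_const_pow_zero R)).congr_left
      fun p => by ring
  have hs_bd : ∀ᶠ p in rayFilter, |s p| ≤ 1 + |sA| + R := by
    have h1 := (tendsto_zero_of_isBigO hε s1).norm.eventually_lt_const
      (show ‖(0 : ℝ)‖ < 1 by simp)
    have h2 : ∀ᶠ p : ℝ × ℝ in rayFilter, p.2 ∈ Icc (0 : ℝ) 1 :=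
      eventually_rayFilter.2 (Eventually.of_forall fun t ξ hξ => hξ)
    filter_upwards [h1, h2] with p hp hp2
    have h3 : |p.2 * R| ≤ R := by
      rw [abs_of_nonneg (mul_nonneg hp2.1 S.length_pos.le)]
      exact mul_le_of_le_one_left S.length_pos.le hp2.2
    have h4 : s p = (s p - (sA + p.2 * R)) + sA + p.2 * R := by ring
    rw [Real.norm_eq_abs] at hp
    rw [h4]
    linarith [abs_add_three (s p - (sA + p.2 * R)) sA (p.2 * R)]
  have hv_bd : ∀ᶠ p in rayFilter, R / 2 ≤ v p := by
    filter_upwards [(tendsto_zero_of_isBigO hε v1).eventually_const_lt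
      (show -(R / 2) < 0 by linarith [S.length_pos])] with p hp
    linarith
  -- the deflection evaluated at the actual abscissa
  have η1 : (fun p : ℝ × ℝ => η p - bend (a * m) d α k (sA + p.2 * R)) =O[rayFilter]
      fun p => p.1 ^ 1 :=
    (IsBigO.of_bound _ (Eventually.of_forall fun p => abs_bend_sub_le hd _ _)).trans s1
  have η'1 : (fun p : ℝ × ℝ => η' p - bendDeriv (a * m) d k (sA + p.2 * R)) =O[rayFilter]
      fun p => p.1 ^ 1 :=
    (IsBigO.of_bound _ (Eventually.of_forall fun p => abs_bendDeriv_sub_le hd _ _)).trans s1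
  have η'b : η' =O[rayFilter] fun p => p.1 ^ 0 := by
    rw [isBigO_pow_zero_iff]
    exact IsBigO.of_bound (|a * m / d ^ 2| * (1 + |k|)) (Eventually.of_forall fun p => by
      simpa using abs_bendDeriv_le hd (s p))
  have ηb : η =O[rayFilter] fun p => p.1 ^ 0 := by
    rw [isBigO_pow_zero_iff]
    refine IsBigO.of_bound (|bend (a * m) d α k 0|
      + |a * m / d ^ 2| * (1 + |k|) * (1 + |sA| + R)) ?_
    filter_upwards [hs_bd] with p hp
    have h1 := abs_bend_sub_le (g := a * m) (α := α) (k := k) hd (s p) 0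
    rw [sub_zero] at h1
    have h2 : |a * m / d ^ 2| * (1 + |k|) * |s p|
        ≤ |a * m / d ^ 2| * (1 + |k|) * (1 + |sA| + R) := by gcongr
    have h3 := abs_sub_abs_le_abs_sub (η p) (bend (a * m) d α k 0)
    simp only [norm_one, mul_one, Real.norm_eq_abs, hη] at h3 ⊢
    linarith
  have hdisp' : (fun p => ω p - (p.1 * η p) • D) =O[rayFilter] fun p => p.1 ^ 2 := by
    have h1 := isBigO_smul_pow (isBigO_mul_pow e1 η1 (rfl : 1 + 1 = 2))
      (isBigO_const_pow_zero D) (rfl : 2 + 0 = 2)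
    refine (hdisp.sub h1).congr_left fun p => ?_
    module
  have hvel' : (fun p => ω' p - (p.1 * (η' p * v p)) • D) =O[rayFilter] fun p => p.1 ^ 2 := by
    have h1 : (fun p : ℝ × ℝ => η' p * v p - bendDeriv (a * m) d k (sA + p.2 * R) * R)
        =O[rayFilter] fun p => p.1 ^ 1 :=
      ((isBigO_mul_pow η'b v1 (rfl : 0 + 1 = 1)).add
        (isBigO_mul_pow η'1 (isBigO_const_pow_zero R) (rfl : 1 + 0 = 1))).congr_left
        fun p => by ring
    have h2 := isBigO_smul_pow (isBigO_mul_pow e1 h1 (rfl : 1 + 1 = 2))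
      (isBigO_const_pow_zero D) (rfl : 2 + 0 = 2)
    refine (hvel.sub h2).congr_left fun p => ?_
    module
  have hDD : inner ℝ D D = d ^ 2 := by rw [real_inner_self_eq_norm_sq, S.norm_foot]
  have hw : (fun p => inner ℝ D (ω p) - p.1 * (η p * d ^ 2)) =O[rayFilter]
      fun p => p.1 ^ 2 := by
    refine (isBigO_inner_pow (isBigO_const_pow_zero D) hdisp' (rfl : 0 + 2 = 2)).congr_left
      fun p => ?_
    rw [inner_sub_right, inner_smul_right, hDD]
    ring
  have hwv : (fun p => inner ℝ D (ω' p) - p.1 * (η' p * v p * d ^ 2)) =O[rayFilter]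
      fun p => p.1 ^ 2 := by
    refine (isBigO_inner_pow (isBigO_const_pow_zero D) hvel' (rfl : 0 + 2 = 2)).congr_left
      fun p => ?_
    rw [inner_sub_right, inner_smul_right, hDD]
    ring
  have hW : (fun p => ‖ω p‖ ^ 2 - p.1 ^ 2 * (η p ^ 2 * d ^ 2)) =O[rayFilter]
      fun p => p.1 ^ 3 := by
    have h1 : (fun p => (p.1 * η p) • D) =O[rayFilter] fun p => p.1 ^ 1 :=
      isBigO_smul_pow (isBigO_mul_pow e1 ηb (rfl : 1 + 0 = 1))
        (isBigO_const_pow_zero D) (rfl : 1 + 0 = 1)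
    have h2 : (fun p => ω p + (p.1 * η p) • D) =O[rayFilter] fun p => p.1 ^ 1 := by
      refine ((isBigO_pow_of_le hε one_le_two hdisp').add (h1.add h1)).congr_left fun p => ?_
      module
    refine (isBigO_inner_pow hdisp' h2 (rfl : 2 + 1 = 3)).congr_left fun p => ?_
    simp only [inner_sub_left, inner_add_right, inner_smul_left, inner_smul_right, hDD,
      real_inner_self_eq_norm_sq, real_inner_comm D (ω p), conj_trivial]
    ring
  have hWv : (fun p => ‖ω' p‖ ^ 2 - (2 * p.1 * (η' p * v p) * inner ℝ D (ω' p)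
      - p.1 ^ 2 * ((η' p * v p) ^ 2 * d ^ 2))) =O[rayFilter] fun p => p.1 ^ 4 := by
    refine (isBigO_inner_pow hvel' hvel' (rfl : 2 + 2 = 4)).congr_left fun p => ?_
    simp only [inner_sub_left, inner_sub_right, inner_smul_left, inner_smul_right, hDD,
      real_inner_self_eq_norm_sq, real_inner_comm D (ω' p), conj_trivial]
    ring
  have hnx : ∀ p, √(s p ^ 2 + d ^ 2 + (2 * inner ℝ D (ω p) + ‖ω p‖ ^ 2)) = ‖x p‖ := by
    intro p
    have h1 : transProj e (x p) = D + ω p := by simp only [hω]; abel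
    rw [← Real.sqrt_sq (norm_nonneg (x p)), norm_sq_eq_add_transProj S.norm_dir (x p), h1,
      norm_add_sq_real, S.norm_foot]
    congr 1
    ring
  have hnv : ∀ p, √(v p ^ 2 + ‖ω' p‖ ^ 2) = ‖x' p‖ := by
    intro p
    rw [← Real.sqrt_sq (norm_nonneg (x' p)), norm_sq_eq_add_transProj S.norm_dir (x' p)]
  have main := index_mul_speed_sub_isBigO (m := m) hε hN hd (half_pos S.length_pos) hs_bd hv_bd vb
    ηb η'b hw hW hwv hWv (fun p => by positivity)
  simp only [hnx, hnv] at main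
  -- the remainder of the time coordinate has a derivative of fourth order
  set Ψ : ℝ × ℝ → ℝ := fun p => rayTime c tA xA xB X0 p.1 p.2 - (s p + p.1 * F₁ (s p)
    + p.1 ^ 2 * F₂ (s p) + p.1 ^ 3 * F₃ (s p) + p.1 * (η' p * inner ℝ D (ω p))) with hΨ
  set G : ℝ × ℝ → ℝ := fun p => derivWithin (rayTime c tA xA xB X0 p.1) (Icc 0 1) p.2
      - (v p * (1 + p.1 * (a * m * (lineDist d (s p))⁻¹)
          - p.1 * (a * m * (lineDist d (s p))⁻¹ ^ 3 * inner ℝ D (ω p))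
          + p.1 ^ 2 * (b * m ^ 2 * (lineDist d (s p))⁻¹ ^ 2 - η' p ^ 2 * d ^ 2 / 2)
          + p.1 ^ 3 * (b' * m ^ 3 * (lineDist d (s p))⁻¹ ^ 3
            - 2 * b * m ^ 2 * η p * d ^ 2 * (lineDist d (s p))⁻¹ ^ 4
            + a * m * η p ^ 2 * d ^ 2 * (-(lineDist d (s p))⁻¹ ^ 3 / 2
              + 3 / 2 * d ^ 2 * (lineDist d (s p))⁻¹ ^ 5)
            + a * m * η' p ^ 2 * d ^ 2 * (lineDist d (s p))⁻¹ / 2))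
        + p.1 * (η' p * inner ℝ D (ω' p))) with hG
  have hG4 : G =O[rayFilter] fun p => p.1 ^ 4 := by
    refine main.congr' ?_ EventuallyEq.rfl
    filter_upwards [h.derivWithin_rayTime_eq S hq hA hB] with p hp
    rw [hG]
    simp only [← hp, hx, hx', lineDist]
  have hΨd : ∀ᶠ t in 𝓝[>] (0 : ℝ), ∀ ξ ∈ Icc (0 : ℝ) 1,
      HasDerivWithinAt (fun ζ => Ψ (t, ζ)) (G (t, ξ)) (Icc 0 1) ξ := by
    filter_upwards [h.eventually_isNullGeodesic] with t hgeo ξ hξ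
    have k1 := (hgeo.contDiffOn_time.differentiableOn two_ne_zero ξ hξ).hasDerivWithinAt
    have k2 := (hgeo.contDiffOn_space.differentiableOn two_ne_zero ξ hξ).hasDerivWithinAt
    have k3 : HasDerivWithinAt (fun ζ => s (t, ζ)) (v (t, ξ)) (Icc 0 1) ξ := by
      simpa using (hasDerivWithinAt_const ξ (Icc 0 1) e).inner ℝ k2
    have k4 := ((transProj e).hasFDerivAt.comp_hasDerivWithinAt ξ k2).sub_const D
    have k5 : HasDerivWithinAt (fun ζ => inner ℝ D (ω (t, ζ))) (inner ℝ D (ω' (t, ξ)))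
        (Icc 0 1) ξ := by
      simpa using (hasDerivWithinAt_const ξ (Icc 0 1) D).inner ℝ k4
    have f1 := (h₁ (s (t, ξ))).comp_hasDerivWithinAt ξ k3
    have f2 := (h₂ (s (t, ξ))).comp_hasDerivWithinAt ξ k3
    have f3 := (h₃ (s (t, ξ))).comp_hasDerivWithinAt ξ k3
    have f4 := (hasDerivAt_bendDeriv (g := a * m) (k := k) hd (s (t, ξ))).comp_hasDerivWithinAt ξ k3
    have k6 := k1.sub ((((k3.add (f1.const_mul t)).add (f2.const_mul (t ^ 2))).add
      (f3.const_mul (t ^ 3))).add ((f4.mul k5).const_mul t))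
    refine k6.congr_deriv ?_
    simp only [hG, hη, hη', Function.comp]
    ring
  have hΨ4 := isBigO_eval_one (isBigO_sub_of_hasDerivWithinAt hΨd hG4)
  have hT := h.rayTime_one_isBigO
  have ω0 : ∀ t, ω (t, 0) = 0 := fun t => by
    simp only [hω, hx, h.rayPos_zero, S.transProj_left, sub_self]
  have ω1 : ∀ t, ω (t, 1) = 0 := fun t => by
    simp only [hω, hx, h.rayPos_one, S.transProj_right, sub_self]
  have s0 : ∀ t, s (t, 0) = sA := fun t => by
    simp only [hs, hx, h.rayPos_zero, S.inner_left]
  have s1' : ∀ t, s (t, 1) = sA + R := fun t => by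
    simp only [hs, hx, h.rayPos_one, S.inner_right]
  have hfin := eq_zero_of_isBigO_pow_four (c₀ := 0) (c₁ := X0 1 1 - (F₁ (sA + R) - F₁ sA))
    (c₂ := X0 2 1 - (F₂ (sA + R) - F₂ sA)) (c₃ := X0 3 1 - (F₃ (sA + R) - F₃ sA)) <| by
    refine (hΨ4.sub hT).congr_left fun t => ?_
    simp only [hΨ, ω0, ω1, s0, s1', inner_zero_right, h.rayTime_zero, S.norm_sub]
    ring
  exact ⟨sub_eq_zero.1 hfin.2.2.1, sub_eq_zero.1 hfin.2.2.2⟩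

end IsQuasiMinkowskianRay

/-! ### The quadratures -/

/-- An antiderivative of the inverse square of `lineDist`; multiplied by `d` it is the polar angle
along the line. -/
def lineAngle (d s : ℝ) : ℝ := Real.arctan (s / d) / d

theorem hasDerivAt_lineAngle {d : ℝ} (hd : 0 < d) (s : ℝ) :
    HasDerivAt (lineAngle d) ((lineDist d s)⁻¹ ^ 2) s := by
  have h := ((hasDerivAt_id s).div_const d).arctan.div_const d
  refine h.congr_deriv ?_
  rw [inv_pow, lineDist_sq]
  simp only [id]
  field_simp
  ring

theorem hasDerivAt_inv_lineDist {d : ℝ} (hd : 0 < d) (s : ℝ) :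
    HasDerivAt (fun s => (lineDist d s)⁻¹) (-(s * (lineDist d s)⁻¹ ^ 3)) s := by
  have h0 := (lineDist_pos hd s).ne'
  refine ((hasDerivAt_lineDist hd s).inv h0).congr_deriv ?_
  field_simp

theorem sqrt_one_add_div_sq {d : ℝ} (hd : 0 < d) (s : ℝ) :
    √(1 + (s / d) ^ 2) = lineDist d s / d := by
  have h : 1 + (s / d) ^ 2 = (lineDist d s / d) ^ 2 := by
    rw [div_pow, div_pow, lineDist_sq]
    field_simp
    ring
  rw [h, Real.sqrt_sq (div_nonneg (lineDist_pos hd s).le hd.le)]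

theorem hasDerivAt_arsinh_div {d : ℝ} (hd : 0 < d) (s : ℝ) :
    HasDerivAt (fun s => Real.arsinh (s / d)) ((lineDist d s)⁻¹) s := by
  refine (((hasDerivAt_id s).div_const d).arsinh).congr_deriv ?_
  have h0 := (lineDist_pos hd s).ne'
  simp only [id, sqrt_one_add_div_sq hd, smul_eq_mul]
  field_simp

/-- The second order part of the time coordinate as a function of the abscissa, for the index
parameters `κ`, `a` and for the deflection with slope parameter `k`. -/
def secondOrderQuad (κ a m d k s : ℝ) : ℝ :=
  κ * m ^ 2 * lineAngle d s
    - a ^ 2 * m ^ 2 / (2 * d ^ 2) * (s - 2 * k * lineDist d s + k ^ 2 * s)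

theorem hasDerivAt_secondOrderQuad {κ a m d k : ℝ} (hd : 0 < d) (s : ℝ) :
    HasDerivAt (secondOrderQuad κ a m d k) ((κ - a ^ 2 / 2) * m ^ 2 * (lineDist d s)⁻¹ ^ 2
      - bendDeriv (a * m) d k s ^ 2 * d ^ 2 / 2) s := by
  have h := ((hasDerivAt_lineAngle hd s).const_mul (κ * m ^ 2)).sub
    ((((hasDerivAt_id s).sub ((hasDerivAt_lineDist hd s).const_mul (2 * k))).add
      ((hasDerivAt_id s).const_mul (k ^ 2))).const_mul (a ^ 2 * m ^ 2 / (2 * d ^ 2)))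
  refine h.congr_deriv ?_
  have h0 := (lineDist_pos hd s).ne'
  have h2 := lineDist_sq d s
  simp only [bendDeriv]
  field_simp
  linear_combination (-(a ^ 2 * m ^ 2)) * h2

/-- The third order part of the time coordinate as a function of the abscissa. The factor
`lineDist d s - α - k * s`, proportional to the deflection, vanishes at both ends of the ray. -/
def thirdOrderQuad (κ κ₃ a m d α k s : ℝ) : ℝ :=
  m ^ 3 * (κ₃ / d ^ 2 * (s * (lineDist d s)⁻¹)
    + a * κ / d ^ 2 * (s * (lineDist d s)⁻¹ - α * (s * (lineDist d s)⁻¹ ^ 2)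
        - α * lineAngle d s + k * d ^ 2 * (lineDist d s)⁻¹ ^ 2)
    + a ^ 3 / (2 * d ^ 4) * ((α ^ 2 - (2 + k ^ 2) * d ^ 2) * (s * (lineDist d s)⁻¹)
        - 2 * α * k * d ^ 2 * (lineDist d s)⁻¹
        + 2 * α * d ^ 2 * (s * (lineDist d s)⁻¹ ^ 2) - 2 * k * d ^ 4 * (lineDist d s)⁻¹ ^ 2
        + d ^ 2 * ((lineDist d s - α - k * s) ^ 2 * (s * (lineDist d s)⁻¹ ^ 3)
          + 2 * ((lineDist d s - α - k * s)
            * (s * (lineDist d s)⁻¹ ^ 2 - k * (lineDist d s)⁻¹)))))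

theorem hasDerivAt_thirdOrderQuad {κ κ₃ a m d α k : ℝ} (hd : 0 < d) (s : ℝ) :
    HasDerivAt (thirdOrderQuad κ κ₃ a m d α k)
      ((κ₃ - a * κ + a ^ 3 / 2) * m ^ 3 * (lineDist d s)⁻¹ ^ 3
      - 2 * (κ - a ^ 2 / 2) * m ^ 2 * bend (a * m) d α k s * d ^ 2 * (lineDist d s)⁻¹ ^ 4
      + a * m * bend (a * m) d α k s ^ 2 * d ^ 2 * (-(lineDist d s)⁻¹ ^ 3 / 2
        + 3 / 2 * d ^ 2 * (lineDist d s)⁻¹ ^ 5)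
      + a * m * bendDeriv (a * m) d k s ^ 2 * d ^ 2 * (lineDist d s)⁻¹ / 2) s := by
  have hi := hasDerivAt_inv_lineDist hd s
  have hρ := hasDerivAt_lineDist hd s
  have hs := hasDerivAt_id s
  have hi2 : HasDerivAt (fun s => (lineDist d s)⁻¹ ^ 2) (-(2 * s * (lineDist d s)⁻¹ ^ 4)) s :=
    (hi.fun_pow 2).congr_deriv (by norm_num; ring)
  have hi3 : HasDerivAt (fun s => (lineDist d s)⁻¹ ^ 3) (-(3 * s * (lineDist d s)⁻¹ ^ 5)) s :=
    (hi.fun_pow 3).congr_deriv (by norm_num; ring)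
  have hf : HasDerivAt (fun s => lineDist d s - α - k * s) (s * (lineDist d s)⁻¹ - k) s :=
    ((hρ.sub_const α).sub (hs.const_mul k)).congr_deriv (by ring)
  have hf2 : HasDerivAt (fun s => (lineDist d s - α - k * s) ^ 2)
      (2 * (lineDist d s - α - k * s) * (s * (lineDist d s)⁻¹ - k)) s :=
    (hf.fun_pow 2).congr_deriv (by norm_num)
  have hsi := hs.mul hi
  have hsi2 := hs.mul hi2
  have hsi3 := hs.mul hi3
  have h := (((hsi.const_mul (κ₃ / d ^ 2)).add
    ((((hsi.sub (hsi2.const_mul α)).sub ((hasDerivAt_lineAngle hd s).const_mul α)).add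
      (hi2.const_mul (k * d ^ 2))).const_mul (a * κ / d ^ 2))).add
    ((((((hsi.const_mul (α ^ 2 - (2 + k ^ 2) * d ^ 2)).sub
        (hi.const_mul (2 * α * k * d ^ 2))).add
        (hsi2.const_mul (2 * α * d ^ 2))).sub (hi2.const_mul (2 * k * d ^ 4))).add
        (((hf2.mul hsi3).add
          ((hf.mul (hsi2.sub (hi.const_mul k))).const_mul 2)).const_mul
          (d ^ 2))).const_mul (a ^ 3 / (2 * d ^ 4)))).const_mul (m ^ 3)
  refine h.congr_deriv ?_
  have h0 := (lineDist_pos hd s).ne'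
  have h2 := lineDist_sq d s
  have hd2 : d ^ 2 = lineDist d s ^ 2 - s ^ 2 := by linarith
  have hd4 : d ^ 4 = (lineDist d s ^ 2 - s ^ 2) ^ 2 := by rw [← hd2]; ring
  have hd0 : lineDist d s ^ 2 - s ^ 2 ≠ 0 := by rw [← hd2]; positivity
  simp only [bend, bendDeriv, Pi.mul_apply, Pi.sub_apply, id, hd2, hd4]
  generalize lineDist d s = ρ at *
  field_simp
  ring

/-! ### Evaluation at the ends of the ray -/

/-- Rational parametrization of the distance from the centre along a line: it turns the relations
between the distances and the abscissae of the end points into identities of rational functions. -/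
theorem exists_rational_param {s d r : ℝ} (hd : 0 < d) (hr : 0 < r) (h : r ^ 2 = s ^ 2 + d ^ 2) :
    ∃ p, 0 < p ∧ s = d * (p ^ 2 - 1) / (2 * p) ∧ r = d * (p ^ 2 + 1) / (2 * p) := by
  have h1 : 0 < r + s := by
    have : |s| < r := abs_lt_of_sq_lt_sq (by nlinarith) hr.le
    linarith [(abs_lt.1 this).1]
  refine ⟨(r + s) / d, by positivity, ?_, ?_⟩
  · field_simp
    linear_combination (-1) * h
  · field_simp
    linear_combination h

theorem secondOrderQuad_sub {κ a m d k s₁ s₂ r₁ r₂ : ℝ} (hd : 0 < d) (hs : s₁ < s₂)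
    (h₁ : r₁ = lineDist d s₁) (h₂ : r₂ = lineDist d s₂) (hk : k = (r₂ - r₁) / (s₂ - s₁)) :
    secondOrderQuad κ a m d k s₂ - secondOrderQuad κ a m d k s₁
      = κ * m ^ 2 * (lineAngle d s₂ - lineAngle d s₁)
        - a ^ 2 * m ^ 2 * (s₂ - s₁) / (r₁ * r₂ + s₁ * s₂ + d ^ 2) := by
  have hr₁ : 0 < r₁ := h₁ ▸ lineDist_pos hd s₁
  have hr₂ : 0 < r₂ := h₂ ▸ lineDist_pos hd s₂
  simp only [secondOrderQuad, ← h₁, ← h₂]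
  obtain ⟨p, hp, e₁, f₁⟩ := exists_rational_param hd hr₁ (h₁ ▸ lineDist_sq d s₁)
  obtain ⟨q, hq, e₂, f₂⟩ := exists_rational_param hd hr₂ (h₂ ▸ lineDist_sq d s₂)
  have hR : s₂ - s₁ = d * (q - p) * (p * q + 1) / (2 * p * q) := by
    rw [e₁, e₂]; field_simp; ring
  have hW : r₁ * r₂ + s₁ * s₂ + d ^ 2 = d ^ 2 * (p * q + 1) ^ 2 / (2 * p * q) := by
    rw [e₁, e₂, f₁, f₂]; field_simp; ring
  have hk' : k = (p * q - 1) / (p * q + 1) := by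
    have hqp : q - p ≠ 0 := by
      intro h0
      rw [h0] at hR
      simp at hR
      linarith
    rw [hk, hR, f₁, f₂]; field_simp; ring
  have hpq : 0 < p * q + 1 := by positivity
  generalize lineAngle d s₁ = A₁
  generalize lineAngle d s₂ = A₂
  rw [hW, hk', f₁, f₂, e₁, e₂]
  field_simp
  ring

theorem thirdOrderQuad_sub {κ κ₃ a m d α k s₁ s₂ r₁ r₂ : ℝ} (hd : 0 < d) (hs : s₁ < s₂)
    (h₁ : r₁ = lineDist d s₁) (h₂ : r₂ = lineDist d s₂) (hk : k = (r₂ - r₁) / (s₂ - s₁))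
    (hα : α + k * s₁ = r₁) (hα' : α + k * s₂ = r₂) :
    thirdOrderQuad κ κ₃ a m d α k s₂ - thirdOrderQuad κ κ₃ a m d α k s₁
      = m ^ 3 * (r₁ + r₂) / (r₁ * r₂ + s₁ * s₂ + d ^ 2)
        * (κ₃ * (s₂ - s₁) / (r₁ * r₂) - a * κ * (lineAngle d s₂ - lineAngle d s₁)
          + a ^ 3 * (s₂ - s₁) / (r₁ * r₂ + s₁ * s₂ + d ^ 2)) := by
  have hr₁ : 0 < r₁ := h₁ ▸ lineDist_pos hd s₁
  have hr₂ : 0 < r₂ := h₂ ▸ lineDist_pos hd s₂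
  have z₁ : r₁ - α - k * s₁ = 0 := by linarith
  have z₂ : r₂ - α - k * s₂ = 0 := by linarith
  simp only [thirdOrderQuad, ← h₁, ← h₂, z₁, z₂]
  obtain ⟨p, hp, e₁, f₁⟩ := exists_rational_param hd hr₁ (h₁ ▸ lineDist_sq d s₁)
  obtain ⟨q, hq, e₂, f₂⟩ := exists_rational_param hd hr₂ (h₂ ▸ lineDist_sq d s₂)
  have hR : s₂ - s₁ = d * (q - p) * (p * q + 1) / (2 * p * q) := by
    rw [e₁, e₂]; field_simp; ring
  have hW : r₁ * r₂ + s₁ * s₂ + d ^ 2 = d ^ 2 * (p * q + 1) ^ 2 / (2 * p * q) := by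
    rw [e₁, e₂, f₁, f₂]; field_simp; ring
  have hpq : 0 < p * q + 1 := by positivity
  have hk' : k = (p * q - 1) / (p * q + 1) := by
    have hqp : q - p ≠ 0 := by
      intro h0
      rw [h0] at hR
      simp at hR
      linarith
    rw [hk, hR, f₁, f₂]; field_simp; ring
  have hα'' : α = d * (p + q) / (p * q + 1) := by
    have : α = r₁ - k * s₁ := by linarith
    rw [this, hk', f₁, e₁]; field_simp; ring
  generalize lineAngle d s₁ = A₁
  generalize lineAngle d s₂ = A₂
  have hp2 : 0 < p ^ 2 + 1 := by positivity
  have hq2 : 0 < q ^ 2 + 1 := by positivity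
  have hd0 := hd.ne'
  -- the coefficients of `κ₃`, `a κ` and `a ^ 3`
  have c₁ : (s₂ * r₂⁻¹ - s₁ * r₁⁻¹) / d ^ 2
      = (r₁ + r₂) / (r₁ * r₂ + s₁ * s₂ + d ^ 2) * ((s₂ - s₁) / (r₁ * r₂)) := by
    rw [hW, hR, f₁, f₂, e₁, e₂]
    field_simp
    ring
  have c₂ : (s₂ * r₂⁻¹ - α * (s₂ * r₂⁻¹ ^ 2) + k * d ^ 2 * r₂⁻¹ ^ 2)
      - (s₁ * r₁⁻¹ - α * (s₁ * r₁⁻¹ ^ 2) + k * d ^ 2 * r₁⁻¹ ^ 2) = 0 := by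
    rw [hk', hα'', f₁, f₂, e₁, e₂]
    field_simp
    ring
  have c₂' : α / d ^ 2 = (r₁ + r₂) / (r₁ * r₂ + s₁ * s₂ + d ^ 2) := by
    rw [hW, hα'', f₁, f₂]
    field_simp
    ring
  have c₃ : ((α ^ 2 - (2 + k ^ 2) * d ^ 2) * (s₂ * r₂⁻¹) - 2 * α * k * d ^ 2 * r₂⁻¹
      + 2 * α * d ^ 2 * (s₂ * r₂⁻¹ ^ 2) - 2 * k * d ^ 4 * r₂⁻¹ ^ 2)
      - ((α ^ 2 - (2 + k ^ 2) * d ^ 2) * (s₁ * r₁⁻¹) - 2 * α * k * d ^ 2 * r₁⁻¹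
      + 2 * α * d ^ 2 * (s₁ * r₁⁻¹ ^ 2) - 2 * k * d ^ 4 * r₁⁻¹ ^ 2)
      = 2 * d ^ 4 * ((r₁ + r₂) / (r₁ * r₂ + s₁ * s₂ + d ^ 2)
        * ((s₂ - s₁) / (r₁ * r₂ + s₁ * s₂ + d ^ 2))) := by
    rw [hW, hR, hk', hα'', f₁, f₂, e₁, e₂]
    field_simp
    ring
  have hd4 : a ^ 3 / (2 * d ^ 4) * (2 * d ^ 4) = a ^ 3 := by field_simp
  linear_combination m ^ 3 * κ₃ * c₁ + m ^ 3 * a * κ / d ^ 2 * c₂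
    - m ^ 3 * a * κ * (A₂ - A₁) * c₂' + m ^ 3 * (a ^ 3 / (2 * d ^ 4)) * c₃
    + m ^ 3 * ((r₁ + r₂) / (r₁ * r₂ + s₁ * s₂ + d ^ 2)
        * ((s₂ - s₁) / (r₁ * r₂ + s₁ * s₂ + d ^ 2))) * hd4

theorem lineAngle_sub {d s₁ s₂ : ℝ} (hd : 0 < d) (hs : s₁ < s₂) :
    lineAngle d s₂ - lineAngle d s₁
      = Real.arccos ((s₁ * s₂ + d ^ 2) / (lineDist d s₁ * lineDist d s₂)) / d := by
  have hc : Real.cos (Real.arctan (s₂ / d) - Real.arctan (s₁ / d))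
      = (s₁ * s₂ + d ^ 2) / (lineDist d s₁ * lineDist d s₂) := by
    have h1 := (lineDist_pos hd s₁).ne'
    have h2 := (lineDist_pos hd s₂).ne'
    rw [Real.cos_sub, Real.cos_arctan, Real.cos_arctan, Real.sin_arctan, Real.sin_arctan,
      sqrt_one_add_div_sq hd, sqrt_one_add_div_sq hd]
    field_simp
    ring
  rw [← hc, Real.arccos_cos, lineAngle, lineAngle, sub_div]
  · exact sub_nonneg.2 (Real.arctan_strictMono.monotone (by gcongr))
  · linarith [Real.arctan_lt_pi_div_two (s₂ / d), Real.neg_pi_div_two_lt_arctan (s₁ / d)]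

/-! ### Geometry of the segment -/

theorem norm_vecCross_sq (a b : E3) :
    ‖vecCross a b‖ ^ 2 = ‖a‖ ^ 2 * ‖b‖ ^ 2 - (inner ℝ a b : ℝ) ^ 2 := by
  simp only [EuclideanSpace.norm_sq_eq, vecCross, cross_apply, Fin.sum_univ_three,
    PiLp.inner_apply, Real.norm_eq_abs, sq_abs]
  simp
  ring

theorem exists_isOffCentreSegment {rh : ℝ} (hrh : 0 < rh) {xA xB : E3}
    (hn : ‖xA‖⁻¹ • xA ≠ ‖xB‖⁻¹ • xB)
    (hseg : ∀ ξ ∈ Icc (0 : ℝ) 1, rh < ‖segPoint xA xB ξ‖) :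
    ∃ e D sA R d, IsOffCentreSegment xA xB e D sA R d := by
  have hne : xB - xA ≠ 0 := fun h => hn (by rw [sub_eq_zero.1 h])
  have hR : 0 < ‖xB - xA‖ := norm_pos_iff.2 hne
  set R := ‖xB - xA‖ with hRdef
  set e : E3 := R⁻¹ • (xB - xA) with he
  have hen : ‖e‖ = 1 := by
    rw [he, norm_smul, norm_inv, Real.norm_of_nonneg hR.le, ← hRdef, inv_mul_cancel₀ hR.ne']
  have hRe : R • e = xB - xA := by rw [he, smul_smul, mul_inv_cancel₀ hR.ne', one_smul]
  set sA : ℝ := inner ℝ e xA with hsA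
  have hD : transProj e xA ≠ 0 := by
    intro h0
    rw [transProj_apply, sub_eq_zero] at h0
    have hB : xB = (sA + R) • e := by rw [add_smul, hRe, ← h0]; abel
    have hz : ∀ ξ : ℝ, segPoint xA xB ξ = (sA + ξ * R) • e := fun ξ => by
      rw [segPoint, ← hRe, h0]; module
    have hdir : ∀ r : ℝ, 0 < r → ‖r • e‖⁻¹ • r • e = e := fun r hr => by
      rw [norm_smul, hen, mul_one, Real.norm_of_nonneg hr.le, smul_smul, inv_mul_cancel₀ hr.ne',
        one_smul]
    have hdir' : ∀ r : ℝ, r < 0 → ‖r • e‖⁻¹ • r • e = -e := fun r hr => by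
      rw [norm_smul, hen, mul_one, Real.norm_of_nonpos hr.le, smul_smul,
        inv_neg, neg_mul, inv_mul_cancel₀ hr.ne, neg_one_smul]
    rcases lt_or_ge 0 sA with h1 | h1
    · refine hn ?_
      rw [hB, h0, hdir _ h1, hdir _ (by linarith)]
    · rcases lt_or_ge (sA + R) 0 with h2 | h2
      · refine hn ?_
        rw [hB, h0, hdir' _ (by linarith), hdir' _ h2]
      · have h3 := hseg (-sA / R) ⟨div_nonneg (by linarith) hR.le, by
          rw [div_le_one hR]; linarith⟩
        rw [hz, div_mul_cancel₀ _ hR.ne', add_neg_cancel, zero_smul, norm_zero] at h3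
        linarith
  refine ⟨e, transProj e xA, sA, R, ‖transProj e xA‖, hen, inner_transProj hen xA, rfl,
    norm_pos_iff.2 hD, hR, ?_, ?_⟩
  · rw [transProj_apply]; abel
  · rw [transProj_apply, add_smul, hRe]; abel

namespace IsOffCentreSegment

variable {xA xB e D : E3} {sA R d : ℝ}

theorem norm_left (S : IsOffCentreSegment xA xB e D sA R d) : ‖xA‖ = lineDist d sA := by
  rw [S.left_eq, S.norm_smul_add]

theorem norm_right (S : IsOffCentreSegment xA xB e D sA R d) : ‖xB‖ = lineDist d (sA + R) := by
  rw [S.right_eq, S.norm_smul_add]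

theorem inner_left_right (S : IsOffCentreSegment xA xB e D sA R d) :
    inner ℝ xA xB = sA * (sA + R) + d ^ 2 := by
  rw [S.left_eq, S.right_eq]
  have h1 : inner ℝ D e = 0 := by rw [real_inner_comm, S.inner_foot]
  have h2 : inner ℝ e e = 1 := by rw [real_inner_self_eq_norm_sq, S.norm_dir, one_pow]
  have h3 : inner ℝ D D = d ^ 2 := by rw [real_inner_self_eq_norm_sq, S.norm_foot]
  simp only [inner_add_left, inner_add_right, inner_smul_left, inner_smul_right, S.inner_foot,
    h1, h2, h3, conj_trivial]
  ring

theorem inner_directions (S : IsOffCentreSegment xA xB e D sA R d) :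
    inner ℝ (‖xA‖⁻¹ • xA) (‖xB‖⁻¹ • xB) = (sA * (sA + R) + d ^ 2) / (‖xA‖ * ‖xB‖) := by
  rw [inner_smul_left, inner_smul_right, S.inner_left_right, conj_trivial]
  field_simp

theorem norm_vecCross_directions (S : IsOffCentreSegment xA xB e D sA R d) :
    ‖vecCross (‖xA‖⁻¹ • xA) (‖xB‖⁻¹ • xB)‖ = d * R / (‖xA‖ * ‖xB‖) := by
  have hA : 0 < ‖xA‖ := S.norm_left ▸ lineDist_pos S.dist_pos _
  have hB : 0 < ‖xB‖ := S.norm_right ▸ lineDist_pos S.dist_pos _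
  have hd := S.dist_pos
  have hR := S.length_pos
  refine (pow_left_inj₀ (norm_nonneg _) (by positivity) two_ne_zero).1 ?_
  rw [norm_vecCross_sq, S.inner_directions, norm_smul, norm_smul, norm_inv, norm_inv, norm_norm,
    norm_norm, inv_mul_cancel₀ hA.ne', inv_mul_cancel₀ hB.ne']
  have h1 : ‖xA‖ ^ 2 = sA ^ 2 + d ^ 2 := by rw [S.norm_left, lineDist_sq]
  have h2 : ‖xB‖ ^ 2 = (sA + R) ^ 2 + d ^ 2 := by rw [S.norm_right, lineDist_sq]
  rw [div_pow, div_pow, mul_pow, h1, h2]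
  have h3 : 0 < sA ^ 2 + d ^ 2 := by positivity
  have h4 : 0 < (sA + R) ^ 2 + d ^ 2 := by positivity
  field_simp
  ring

end IsOffCentreSegment

end

theorem proposition5 (P : PPNParameters) (m rh c tA : ℝ) (hm : 0 < m) (hrh : 0 < rh) (hc : 0 < c)
    (hreg : P.IsRegularOutside m rh) (xA xB : E3) (hA : rh < ‖xA‖) (hB : rh < ‖xB‖)
    (hn : ‖xA‖⁻¹ • xA ≠ ‖xB‖⁻¹ • xB)
    (hseg : ∀ ξ ∈ Icc (0 : ℝ) 1, rh < ‖segPoint xA xB ξ‖)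
    (X0 : ℕ → ℝ → ℝ) (X : ℕ → ℝ → E3)
    (hray : IsQuasiMinkowskianRay P m rh c tA xA xB X0 X)
    (nA nB : E3) (hnA : nA = ‖xA‖⁻¹ • xA) (hnB : nB = ‖xB‖⁻¹ • xB)
    (rA rB : ℝ) (hrA : rA = ‖xA‖) (hrB : rB = ‖xB‖) :
    timeTransferTerm c X0 2 =
      m ^ 2 / (rA * rB) * (‖xB - xA‖ / c) *
        (P.kappa * (Real.arccos (inner ℝ nA nB) / ‖vecCross nA nB‖)
          - (1 + P.gamma) ^ 2 / (1 + inner ℝ nA nB)) ∧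
    timeTransferTerm c X0 3 =
      m ^ 3 / (rA * rB) * (1 / rA + 1 / rB) * (‖xB - xA‖ / (c * (1 + inner ℝ nA nB))) *
        (P.kappa3
          - (1 + P.gamma) * P.kappa * (Real.arccos (inner ℝ nA nB) / ‖vecCross nA nB‖)
          + (1 + P.gamma) ^ 3 / (1 + inner ℝ nA nB)) := by
  obtain ⟨K, q, hq, hKA, hKB⟩ := hreg.exists_bound hm hrh
  obtain ⟨e, D, sA, R, d, S⟩ := exists_isOffCentreSegment hrh hn hseg
  have hd := S.dist_pos
  have hR := S.length_pos
  have hs : sA < sA + R := by linarith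
  have hlA : rA = lineDist d sA := by rw [hrA, S.norm_left]
  have hlB : rB = lineDist d (sA + R) := by rw [hrB, S.norm_right]
  have hrA0 : 0 < rA := hrA ▸ hrh.trans hA
  have hrB0 : 0 < rB := hrB ▸ hrh.trans hB
  set k : ℝ := (rB - rA) / (sA + R - sA) with hk
  set α : ℝ := rA - k * sA with hα
  have hkR : k * R = rB - rA := by
    rw [hk, add_sub_cancel_left, div_mul_cancel₀ _ hR.ne']
  have hα₁ : α + k * sA = rA := by rw [hα]; ring
  have hα₂ : α + k * (sA + R) = rB := by rw [hα]; linarith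
  obtain ⟨h2, h3⟩ := hray.time_terms_eq S hq hKA hKB (hlA ▸ hα₁) (hlB ▸ hα₂) rfl rfl rfl
    (fun s => (hasDerivAt_arsinh_div hd s).const_mul ((1 + P.gamma) * m))
    (fun s => hasDerivAt_secondOrderQuad hd s)
    (fun s => hasDerivAt_thirdOrderQuad (κ₃ := P.kappa3) hd s)
  rw [secondOrderQuad_sub hd hs hlA hlB hk, lineAngle_sub hd hs, ← hlA, ← hlB] at h2
  rw [thirdOrderQuad_sub hd hs hlA hlB hk hα₁ hα₂, lineAngle_sub hd hs, ← hlA, ← hlB] at h3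
  rw [timeTransferTerm, timeTransferTerm, h2, h3, hnA, hnB, S.inner_directions,
    S.norm_vecCross_directions, S.norm_sub, ← hrA, ← hrB]
  generalize Real.arccos _ = θ
  have hW : 0 < rA * rB + sA * (sA + R) + d ^ 2 := by
    have h1 := abs_le_lineDist d sA
    have h4 := abs_le_lineDist d (sA + R)
    rw [← hlA] at h1
    rw [← hlB] at h4
    have h5 : |sA * (sA + R)| ≤ rA * rB := by
      rw [abs_mul]; exact mul_le_mul h1 h4 (abs_nonneg _) hrA0.le
    have := (abs_le.1 h5).1
    have : 0 < d ^ 2 := by positivity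
    linarith
  have h1c : 1 + (sA * (sA + R) + d ^ 2) / (rA * rB)
      = (rA * rB + sA * (sA + R) + d ^ 2) / (rA * rB) := by field_simp; ring
  rw [h1c, show sA + R - sA = R by ring]
  generalize rA * rB + sA * (sA + R) + d ^ 2 = W at *
  constructor
  · field_simp
  · field_simp
    ring
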